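/- Let $\mathbb{K}$ be a commutative field of characteristic zero. A noncrossing partition $\pi$ is a set partition of $[n]=\{1,\dots,n\}$, for some $n\ge 1$, such that there are no two different blocks $b,b'$ of $\pi$ and $x,z\in b$, $y,t\in b'$ with $x<y<z<t$; $|\pi|$ is its number of blocks. The blocks are partially ordered by nesting: $b\le_\pi b'$ if and only if $b'\subseteq[\min b,\max b]$; $\mathrm{Base}(\pi)$ is the set of blocks that are minimal for $\le_\pi$. Let $\mathbb{K}[\mathcal{NCP}]$ be the free commutative algebra generated by the noncrossing partitions. The set $\mathrm{Bl}(P)$ of blocks of a monomial $P=\pi_1\cdots\pi_k$ is the disjoint union of the sets of blocks of $\pi_1,\dots,\pi_k$, with the disjoint union $\le_P$ of the orders $\le_{\pi_i}$. Let $\Lambda,\Lambda^s:\mathbb{K}[\mathcal{NCP}]\to\mathbb{K}[X]$ be the linear maps that send each monomial $P$ to the unique polynomials $\Lambda(P)$, $\Lambda^s(P)$ such that for every integer $n\ge1$, $\Lambda(P)(n)$ is the number of maps $f:\mathrm{Bl}(P)\to[n]$ with $f(b)\le f(b')$ whenever $b\le_P b'$, and $\Lambda^s(P)(n)$ is the number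 of maps $f:\mathrm{Bl}(P)\to[n]$ with $f(b)<f(b')$ whenever $b\le_P b'$ and $b\ne b'$. Let $\lambda,\lambda^s:\mathbb{K}[\mathcal{NCP}]\to\mathbb{K}$ be the algebra morphisms such that for every noncrossing partition $\pi$, $\lambda(\pi)=1$, and $\lambda^s(\pi)=1$ if all blocks of $\pi$ belong to $\mathrm{Base}(\pi)$ and $\lambda^s(\pi)=0$ otherwise. An ideal of $\pi$ is a set $J$ of blocks such that $b\in J$ and $b\le_\pi b'$ imply $b'\in J$. For a set $J$ of blocks, $\pi_{|J}$ is the noncrossing partition obtained by deleting the blocks that are not in $J$ and relabelling the remaining points increasingly by $1,2,\dots$ (with $\pi_{|\emptyset}=1$). If $J$ is an ideal, the connected components (maximal intervals) of the union of the blocks in $J$ are unions of blocks, and $\pi_{|\cdot J}\in\mathbb{K}[\mathcal{NCP}]$ is the product over these components of the restrictions of $\pi$ to the blocks contained in them. Let $\Delta:\mathbb{K}[\mathcal{NCP}]\to\mathbb{K}[\mathcal{NCP}]\otimes\mathbb{K}[\mathcal{NCP}]$ be the algebra morphism with $$\Delta(\pi)=\sum_{J\text{ ideal of }\pi}\pi_{|\pi\setminus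 J}\otimes\pi_{|\cdot J},$$ and let $\varepsilon_\Delta$ be the algebra morphism to $\mathbb{K}$ that vanishes on all noncrossing partitions. Proposition (Duality principle). For every noncrossing partition $\pi$, $$\Lambda(\pi)(X)=(-1)^{|\pi|}\,\Lambda^s(\pi)(-X).$$ Moreover, there is a unique antipode $S$ for $(\mathbb{K}[\mathcal{NCP}],m,\Delta)$, that is, a unique linear endomorphism $S$ of $\mathbb{K}[\mathcal{NCP}]$ with $m\circ(S\otimes\mathrm{Id})\circ\Delta=m\circ(\mathrm{Id}\otimes S)\circ\Delta=\varepsilon_\Delta(\cdot)\,1$, and for every noncrossing partition $\pi$, $$\lambda(\pi)=(-1)^{|\pi|}\,\lambda^s\circ S(\pi).$$ -/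

import Mathlib

open scoped TensorProduct

/-- A noncrossing partition of `[n] = {1, …, n}`, `n ≥ 1` (so it has at least one block). -/
structure NCPart where
  /-- the integer `n` -/
  size : ℕ
  size_pos : 0 < size
  /-- the underlying set partition of `{1, …, n}` -/
  part : Finpartition (Finset.Icc 1 size)
  noncrossing : ∀ b ∈ part.parts, ∀ b' ∈ part.parts, b ≠ b' →
    ∀ x ∈ b, ∀ z ∈ b, ∀ y ∈ b', ∀ t ∈ b', ¬ (x < y ∧ y < z ∧ z < t)

namespace NCPart

/-- The type of blocks of a noncrossing partition. -/
abbrev Block (π : NCPart) : Type := {b : Finset ℕ // b ∈ π.part.parts}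

/-- The number `|π|` of blocks. -/
def numBlocks (π : NCPart) : ℕ := π.part.parts.card

theorem Block.nonempty {π : NCPart} (b : π.Block) : b.1.Nonempty :=
  π.part.nonempty_of_mem_parts b.2

/-- The nesting order `b ≤_π b'`: the block `b'` is contained in `[min b, max b]`. -/
def Nest (π : NCPart) (b b' : π.Block) : Prop :=
  b'.1 ⊆ Finset.Icc (b.1.min' b.nonempty) (b.1.max' b.nonempty)

instance (π : NCPart) : DecidableRel π.Nest := fun b b' =>
  inferInstanceAs (Decidable (b'.1 ⊆ Finset.Icc (b.1.min' b.nonempty) (b.1.max' b.nonempty)))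

/-- The blocks of `π` that are minimal for the nesting order. -/
def base (π : NCPart) : Finset π.Block :=
  Finset.univ.filter fun b => ∀ b' : π.Block, π.Nest b' b → b' = b

/-- A set of blocks is an ideal if it is closed upwards for the nesting order. -/
def IsIdeal (π : NCPart) (J : Finset π.Block) : Prop :=
  ∀ b b' : π.Block, b ∈ J → π.Nest b b' → b' ∈ J

instance (π : NCPart) : DecidablePred π.IsIdeal := fun J =>
  inferInstanceAs (Decidable (∀ b b' : π.Block, b ∈ J → π.Nest b b' → b' ∈ J))

/-- The union `I_J` of the blocks in `J`. -/
def union (π : NCPart) (J : Finset π.Block) : Finset ℕ := J.biUnion fun b => b.1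

/-- For `x ∈ I`, this is the image of `x` under the increasing bijection from `I` to `[|I|]`. -/
def rank (I : Finset ℕ) (x : ℕ) : ℕ := (I.filter (· ≤ x)).card

theorem rank_lt {I : Finset ℕ} {x y : ℕ} (hy : y ∈ I) (h : x < y) : rank I x < rank I y := by
  apply Finset.card_lt_card
  rw [Finset.ssubset_iff_of_subset]
  · exact ⟨y, by simp [hy], by simp [h]⟩
  · intro z hz
    simp only [Finset.mem_filter] at hz ⊢
    exact ⟨hz.1, hz.2.trans h.le⟩

theorem rank_lt_iff {I : Finset ℕ} {x y : ℕ} (hx : x ∈ I) (hy : y ∈ I) :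
    rank I x < rank I y ↔ x < y := by
  refine ⟨fun h => ?_, rank_lt hy⟩
  rcases lt_trichotomy x y with h1 | h1 | h1
  · exact h1
  · subst h1; exact absurd h (lt_irrefl _)
  · exact absurd h (rank_lt hx h1).le.not_gt

theorem rank_injOn (I : Finset ℕ) : Set.InjOn (rank I) (I : Set ℕ) := by
  intro x hx y hy h
  rcases lt_trichotomy x y with h1 | h1 | h1
  · exact absurd h (rank_lt hy h1).ne
  · exact h1
  · exact absurd h (rank_lt hx h1).ne'

theorem image_rank (I : Finset ℕ) : I.image (rank I) = Finset.Icc 1 I.card := by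
  apply Finset.eq_of_subset_of_card_le
  · intro k hk
    obtain ⟨x, hx, rfl⟩ := Finset.mem_image.1 hk
    rw [Finset.mem_Icc]
    exact ⟨Finset.card_pos.2 ⟨x, by simp [hx]⟩, Finset.card_filter_le _ _⟩
  · rw [Finset.card_image_of_injOn (rank_injOn I)]
    simp

theorem subset_union {π : NCPart} {J : Finset π.Block} {b : π.Block} (hb : b ∈ J) :
    b.1 ⊆ π.union J :=
  Finset.subset_biUnion_of_mem (fun b : π.Block => b.1) hb

theorem block_eq {π : NCPart} {b b' : π.Block} {x : ℕ} (h : x ∈ b.1) (h' : x ∈ b'.1) :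
    b = b' := by
  by_contra hne
  exact Finset.disjoint_left.1
    (π.part.disjoint b.2 b'.2 (fun e => hne (Subtype.ext e))) h h'

/-- The restriction `π_{|J}` of `π` to a nonempty set `J` of blocks: the other blocks are
deleted and the remaining points are relabelled increasingly by `1, 2, …`. -/
def restrict (π : NCPart) (J : Finset π.Block) (hJ : J.Nonempty) : NCPart where
  size := (π.union J).card
  size_pos := by
    obtain ⟨b, hb⟩ := hJ
    obtain ⟨x, hx⟩ := b.nonempty
    exact Finset.card_pos.2 ⟨x, subset_union hb hx⟩
  part := Finpartition.ofExistsUnique (J.image fun b => b.1.image (rank (π.union J)))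
    (by
      intro p hp
      obtain ⟨b, hb, rfl⟩ := Finset.mem_image.1 hp
      rw [← image_rank]
      exact Finset.image_subset_image (subset_union hb))
    (by
      intro a ha
      rw [← image_rank] at ha
      obtain ⟨x, hx, rfl⟩ := Finset.mem_image.1 ha
      obtain ⟨b, hb, hxb⟩ := Finset.mem_biUnion.1 hx
      refine ⟨b.1.image (rank (π.union J)),
        ⟨Finset.mem_image_of_mem _ hb, Finset.mem_image_of_mem _ hxb⟩, ?_⟩
      rintro t ⟨ht, hat⟩
      obtain ⟨b', hb', rfl⟩ := Finset.mem_image.1 ht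
      obtain ⟨y, hy, hxy⟩ := Finset.mem_image.1 hat
      have : y = x := rank_injOn _ (subset_union hb' hy) hx hxy
      subst this
      rw [block_eq hy hxb])
    (by
      intro h
      obtain ⟨b, -, hb⟩ := Finset.mem_image.1 h
      exact b.nonempty.ne_empty (Finset.image_eq_empty.1 hb))
  noncrossing := by
    intro p hp p' hp' hne x hx z hz y hy t ht
    obtain ⟨b, hb, rfl⟩ := Finset.mem_image.1 hp
    obtain ⟨b', hb', rfl⟩ := Finset.mem_image.1 hp'
    obtain ⟨x', hx', rfl⟩ := Finset.mem_image.1 hx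
    obtain ⟨z', hz', rfl⟩ := Finset.mem_image.1 hz
    obtain ⟨y', hy', rfl⟩ := Finset.mem_image.1 hy
    obtain ⟨t', ht', rfl⟩ := Finset.mem_image.1 ht
    rw [rank_lt_iff (subset_union hb hx') (subset_union hb' hy'),
      rank_lt_iff (subset_union hb' hy') (subset_union hb hz'),
      rank_lt_iff (subset_union hb hz') (subset_union hb' ht')]
    refine π.noncrossing b.1 b.2 b'.1 b'.2 (fun e => hne ?_) x' hx' z' hz' y' hy' t' ht'
    rw [e]

/-- The connected component of `a` in `I`, that is, the largest interval of integers that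
contains `a` and is contained in `I` (for `a ∈ I`). -/
def component (I : Finset ℕ) (a : ℕ) : Finset ℕ := I.filter fun x => Finset.uIcc a x ⊆ I

/-- The set of connected components of a finite set of integers. -/
def components (I : Finset ℕ) : Finset (Finset ℕ) := I.image (component I)

end NCPart

/-- `𝕂[NCP]`: the free commutative algebra generated by the noncrossing partitions.
The monomials `NCPart →₀ ℕ` form a basis. -/
abbrev NCAlg (K : Type*) [Field K] : Type _ := MvPolynomial NCPart K

namespace NCAlg

variable (K : Type*) [Field K]

/-- A noncrossing partition as an element of `𝕂[NCP]`. -/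
noncomputable def of (π : NCPart) : NCAlg K := MvPolynomial.X π

/-- `π_{|J}` as an element of `𝕂[NCP]`, with the convention `π_{|∅} = 1`. -/
noncomputable def restrict (π : NCPart) (J : Finset π.Block) : NCAlg K :=
  if hJ : J.Nonempty then of K (π.restrict J hJ) else 1

/-- `π_{|·J}`: the product, over the connected components `C` of the union of the blocks in `J`,
of the restrictions of `π` to the blocks contained in `C`. -/
noncomputable def restrictDot (π : NCPart) (J : Finset π.Block) : NCAlg K :=
  ∏ C ∈ NCPart.components (π.union J), restrict K π (Finset.univ.filter fun b => b.1 ⊆ C)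

/-- The coproduct `Δ`: the algebra morphism such that `Δ(π)` is the sum of
`π_{|π∖J} ⊗ π_{|·J}` over the ideals `J` of `π`. -/
noncomputable def comul : NCAlg K →ₐ[K] NCAlg K ⊗[K] NCAlg K :=
  MvPolynomial.aeval fun π =>
    ∑ J ∈ (Finset.univ : Finset (Finset π.Block)).filter π.IsIdeal,
      restrict K π Jᶜ ⊗ₜ[K] restrictDot K π J

/-- The counit `ε_Δ`: the algebra morphism that vanishes on all noncrossing partitions. -/
noncomputable def counit : NCAlg K →ₐ[K] K := MvPolynomial.aeval fun _ => 0

/-- `S` is an antipode of `(𝕂[NCP], m, Δ)`, that is, a two-sided inverse of the identity for the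
convolution product associated with `Δ`. -/
def IsAntipode (S : NCAlg K →ₗ[K] NCAlg K) : Prop :=
  LinearMap.mul' K (NCAlg K) ∘ₗ S.rTensor (NCAlg K) ∘ₗ (comul K).toLinearMap =
      Algebra.linearMap K (NCAlg K) ∘ₗ (counit K).toLinearMap ∧
    LinearMap.mul' K (NCAlg K) ∘ₗ S.lTensor (NCAlg K) ∘ₗ (comul K).toLinearMap =
      Algebra.linearMap K (NCAlg K) ∘ₗ (counit K).toLinearMap

/-- The character `λ` of `𝕂[NCP]`, with `λ(π) = 1` for all noncrossing partitions `π`. -/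
noncomputable def lam : NCAlg K →ₐ[K] K := MvPolynomial.aeval fun _ => 1

/-- The character `λ^s` of `𝕂[NCP]`, with `λ^s(π) = 1` if all blocks of `π` are minimal for the
nesting order, and `λ^s(π) = 0` otherwise. -/
noncomputable def lamS : NCAlg K →ₐ[K] K :=
  MvPolynomial.aeval fun π => if π.base = Finset.univ then 1 else 0

end NCAlg

namespace NCMon

/-- The blocks of a monomial `P` in noncrossing partitions: the disjoint union of the sets of
blocks of its factors, where `π` contributes as many copies as its multiplicity `P π`. -/
abbrev Bl (P : NCPart →₀ ℕ) : Type := Σ i : (Σ π : P.support, Fin (P π.1)), i.1.1.Block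

/-- The order on the blocks of a monomial: the disjoint union of the nesting orders. -/
inductive Nest (P : NCPart →₀ ℕ) : Bl P → Bl P → Prop
  | mk (i : Σ π : P.support, Fin (P π.1)) (b b' : i.1.1.Block) (h : i.1.1.Nest b b') :
      Nest P ⟨i, b⟩ ⟨i, b'⟩

/-- `f` is an `n`-linear extension of `P`. -/
def IsLin (P : NCPart →₀ ℕ) (n : ℕ) (f : Bl P → Fin n) : Prop :=
  ∀ b b', Nest P b b' → f b ≤ f b'

/-- `f` is a strict `n`-linear extension of `P`. -/
def IsLinS (P : NCPart →₀ ℕ) (n : ℕ) (f : Bl P → Fin n) : Prop :=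
  ∀ b b', Nest P b b' → b ≠ b' → f b < f b'

open Classical in
theorem card_eq_sum_choose {α : Type*} [Fintype α] (Q : (n : ℕ) → (α → Fin n) → Prop)
    (hQ : ∀ (k n : ℕ) (e : Fin k ↪o Fin n) (f : α → Fin k), Q n (fun a => e (f a)) ↔ Q k f)
    (n : ℕ) :
    Nat.card {f : α → Fin n // Q n f} =
      ∑ k ∈ Finset.range (Fintype.card α + 1),
        n.choose k * Nat.card {f : α → Fin k // Q k f ∧ Function.Surjective f} := by
  set l : ℕ → ℕ := fun k => Nat.card {f : α → Fin k // Q k f ∧ Function.Surjective f} with hl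
  have hl0 : ∀ k, Fintype.card α < k → l k = 0 := by
    intro k hk
    have : IsEmpty {f : α → Fin k // Q k f ∧ Function.Surjective f} := by
      refine ⟨fun f => ?_⟩
      have := Fintype.card_le_of_surjective _ f.2.2
      simp at this
      omega
    exact Nat.card_of_isEmpty
  have h1 : ∀ s : Finset (Fin n),
      (Finset.univ.filter fun f : α → Fin n => Q n f ∧ Finset.univ.image f = s).card
        = l s.card := by
    intro s
    rw [hl]
    simp only [Nat.card_eq_fintype_card, Fintype.card_subtype]
    symm
    let e := s.orderEmbOfFin rfl
    refine Finset.card_bij (fun f _ => fun a => e (f a)) ?_ ?_ ?_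
    · intro f hf
      simp only [Finset.mem_filter, Finset.mem_univ, true_and] at hf ⊢
      refine ⟨(hQ _ _ e f).2 hf.1, ?_⟩
      ext x
      have hr := Finset.range_orderEmbOfFin s rfl
      have hx : x ∈ s ↔ x ∈ Set.range e := by rw [hr]; simp
      rw [hx]
      simp only [Finset.mem_image, Finset.mem_univ, true_and, Set.mem_range]
      constructor
      · rintro ⟨a, ha⟩; exact ⟨_, ha⟩
      · rintro ⟨k, hk⟩
        obtain ⟨a, ha⟩ := hf.2 k
        exact ⟨a, by rw [ha, hk]⟩
    · intro f _ g _ h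
      funext a
      exact e.injective (congrFun h a)
    · intro g hg
      simp only [Finset.mem_filter, Finset.mem_univ, true_and] at hg
      have hr := Finset.range_orderEmbOfFin s rfl
      have hmem : ∀ a, g a ∈ Set.range e := by
        intro a
        rw [hr, ← hg.2]
        simp
      choose f hf using hmem
      have hfg : (fun a => e (f a)) = g := funext hf
      refine ⟨f, ?_, hfg⟩
      simp only [Finset.mem_filter, Finset.mem_univ, true_and]
      refine ⟨(hQ _ _ e f).1 (by rw [hfg]; exact hg.1), fun k => ?_⟩
      have hk : e k ∈ Finset.univ.image g := by
        rw [hg.2]; exact Finset.orderEmbOfFin_mem s rfl k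
      obtain ⟨a, -, ha⟩ := Finset.mem_image.1 hk
      exact ⟨a, e.injective (by rw [hf, ha])⟩
  have h2 : Nat.card {f : α → Fin n // Q n f} =
      ∑ s ∈ (Finset.univ : Finset (Fin n)).powerset, l s.card := by
    rw [Nat.card_eq_fintype_card, Fintype.card_subtype,
      Finset.card_eq_sum_card_fiberwise (f := fun f => Finset.univ.image f)
        (t := (Finset.univ : Finset (Fin n)).powerset) (by intro f _; simp)]
    refine Finset.sum_congr rfl fun s _ => ?_
    rw [← h1 s, Finset.filter_filter]
  rw [h2, Finset.sum_powerset_apply_card]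
  simp only [Finset.card_univ, Fintype.card_fin, smul_eq_mul]
  set N := max n (Fintype.card α) + 1
  have hA : ∑ m ∈ Finset.range (n + 1), n.choose m * l m =
      ∑ m ∈ Finset.range N, n.choose m * l m := by
    refine Finset.sum_subset (by intro x; simp [N]; omega) fun x _ hx => ?_
    simp at hx
    rw [Nat.choose_eq_zero_of_lt (by omega), zero_mul]
  have hB : ∑ m ∈ Finset.range (Fintype.card α + 1), n.choose m * l m =
      ∑ m ∈ Finset.range N, n.choose m * l m := by
    refine Finset.sum_subset (by intro x; simp [N]; omega) fun x _ hx => ?_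
    simp at hx
    rw [hl0 x (by omega), mul_zero]
  rw [hA, hB]

theorem existsUnique_poly (K : Type*) [Field K] [CharZero K] {α : Type*} [Finite α]
    (Q : (n : ℕ) → (α → Fin n) → Prop)
    (hQ : ∀ (k n : ℕ) (e : Fin k ↪o Fin n) (f : α → Fin k), Q n (fun a => e (f a)) ↔ Q k f) :
    ∃! p : Polynomial K, ∀ n : ℕ, 1 ≤ n →
      p.eval (n : K) = (Nat.card {f : α → Fin n // Q n f} : K) := by
  have := Fintype.ofFinite α
  refine ⟨∑ k ∈ Finset.range (Fintype.card α + 1),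
    Polynomial.C ((Nat.card {f : α → Fin k // Q k f ∧ Function.Surjective f} : K) /
      (k.factorial : K)) * descPochhammer K k, ?_, ?_⟩
  · intro n _
    rw [card_eq_sum_choose Q hQ n, Polynomial.eval_finsetSum]
    push_cast
    refine Finset.sum_congr rfl fun k _ => ?_
    rw [Polynomial.eval_mul, Polynomial.eval_C, descPochhammer_eval_eq_descFactorial,
      Nat.descFactorial_eq_factorial_mul_choose]
    have : (k.factorial : K) ≠ 0 := by exact_mod_cast k.factorial_ne_zero
    push_cast
    field_simp
  · intro q hq
    refine Polynomial.eq_of_infinite_eval_eq _ _ (Set.Infinite.mono (s := (fun n : ℕ => (n : K)) ''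
      Set.Ici 1) ?_ ((Set.Ici_infinite 1).image Nat.cast_injective.injOn))
    rintro _ ⟨n, hn, rfl⟩
    simp only [Set.mem_ofPred_eq]
    rw [hq n hn]
    symm
    rw [card_eq_sum_choose Q hQ n, Polynomial.eval_finsetSum]
    push_cast
    refine Finset.sum_congr rfl fun k _ => ?_
    rw [Polynomial.eval_mul, Polynomial.eval_C, descPochhammer_eval_eq_descFactorial,
      Nat.descFactorial_eq_factorial_mul_choose]
    have : (k.factorial : K) ≠ 0 := by exact_mod_cast k.factorial_ne_zero
    push_cast
    field_simp

theorem existsUnique_lin (K : Type*) [Field K] [CharZero K] (P : NCPart →₀ ℕ) :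
    ∃! p : Polynomial K, ∀ n : ℕ, 1 ≤ n →
      p.eval (n : K) = (Nat.card {f : Bl P → Fin n // IsLin P n f} : K) :=
  existsUnique_poly K (IsLin P) fun k n e f => by simp [IsLin]

theorem existsUnique_linS (K : Type*) [Field K] [CharZero K] (P : NCPart →₀ ℕ) :
    ∃! p : Polynomial K, ∀ n : ℕ, 1 ≤ n →
      p.eval (n : K) = (Nat.card {f : Bl P → Fin n // IsLinS P n f} : K) :=
  existsUnique_poly K (IsLinS P) fun k n e f => by simp [IsLinS]

end NCMon

namespace NCAlg

variable (K : Type*) [Field K] [CharZero K]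

/-- The linear map `Λ : 𝕂[NCP] → 𝕂[X]` that sends a monomial `P` to the unique polynomial whose
value at every integer `n ≥ 1` is the number of `n`-linear extensions of `P`. -/
noncomputable def Lam : NCAlg K →ₗ[K] Polynomial K :=
  (MvPolynomial.basisMonomials NCPart K).constr K fun P => (NCMon.existsUnique_lin K P).choose

/-- The linear map `Λ^s : 𝕂[NCP] → 𝕂[X]` that sends a monomial `P` to the unique polynomial whose
value at every integer `n ≥ 1` is the number of strict `n`-linear extensions of `P`. -/
noncomputable def LamS : NCAlg K →ₗ[K] Polynomial K :=
  (MvPolynomial.basisMonomials NCPart K).constr K fun P => (NCMon.existsUnique_linS K P).choose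

end NCAlg

/-! Both identities come down to alternating sums over sets of maximal blocks.

Reciprocity holds for every finite set with a relation that strictly raises some height; for blocks
the height is the minimum. Let `p_F` and `q_F` be the polynomials that count weak and strict maps on
`F`. Sorting the maps with `n + 1` values by their fibre over the top value gives `q_F(n + 1) = ∑
q_{F∖J}(n)` over the sets `J` of maximal elements, and `p_F(n + 1) = ∑ p_{F∖I}(n)` over the up-sets
`I`. Möbius inversion turns the second formula into `p_F(n) = ∑ (-1)^|J| p_{F∖J}(n + 1)`, again over
sets of maximal elements (`OrderPoly.card_maps_true`). The first, read at negative arguments, is the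
same recursion for `(-1)^|F| q_F(-x)`, so that induction on `F` and the value at 0 give equality
(`OrderPoly.eq_comp_neg`).

For the antipode, most of the work is coassociativity. Iterated restrictions are all rewritten as
restrictions of one fixed `π`, with ideals and connectivity relative to the set `A` of blocks that
remain. Both iterated coproducts then become sums over pairs of disjoint sets of blocks, or
equivalently over chains of ideals `I ⊆ J`, and a bijection matches their terms. Since a proper
restriction has fewer blocks and the algebra is free, every character has a left convolution
inverse, defined recursively on generators; applied to the identity, this gives the antipode.

Finally `lamS ∘ S` is the convolution inverse of `lamS`, and this inverse is `π ↦ (-1)^|π|`: by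
`lamS_relDot` only sets of maximal blocks contribute to the convolution, and their signs cancel
because a maximal block exists. -/

theorem Finset.prod_image_filter_rel {α ι M : Type*} [DecidableEq α] [DecidableEq ι] [CommMonoid M]
    (J : Finset α) (r : α → α → Prop) [DecidableRel r] (c : α → ι)
    (h : ∀ b ∈ J, ∀ b' ∈ J, r b b' ↔ c b = c b') (F : Finset α → M) (hF : F ∅ = 1)
    (T : Finset ι) (hT : ∀ b ∈ J, c b ∈ T) :
    ∏ S ∈ J.image (fun b => J.filter (r b)), F S = ∏ i ∈ T, F (J.filter (c · = i)) := by
  have h1 : ∏ i ∈ T, F (J.filter (c · = i)) = ∏ i ∈ J.image c, F (J.filter (c · = i)) := by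
    symm
    refine Finset.prod_subset (Finset.image_subset_iff.2 hT) fun i _ hi => ?_
    rw [Finset.filter_eq_empty_iff.2, hF]
    rintro b hb rfl
    exact hi (Finset.mem_image_of_mem _ hb)
  have h2 : J.image (fun b => J.filter (r b)) =
      (J.image c).image fun i => J.filter (c · = i) := by
    rw [Finset.image_image]
    refine Finset.image_congr fun b hb => Finset.filter_congr fun b' hb' => ?_
    rw [h b hb b' hb', eq_comm]
  rw [h1, h2, Finset.prod_image]
  intro i hi j _ hij
  obtain ⟨b, hb, rfl⟩ := Finset.mem_image.1 hi
  have : b ∈ J.filter (c · = j) := by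
    rw [← show J.filter (c · = c b) = J.filter (c · = j) from hij]
    simp [hb]
  exact (Finset.mem_filter.1 this).2

/-! ### Nesting, relative ideals and connectivity -/

namespace NCPart

variable {π : NCPart}

theorem ext_of_parts {π σ : NCPart} (hs : π.size = σ.size) (hp : π.part.parts = σ.part.parts) :
    π = σ := by
  cases π with | mk n hn p hnc =>
  cases σ with | mk m hm q hnc' =>
  cases hs
  congr
  exact Finpartition.ext hp

/-- The smallest point of a block. -/
def Block.min (b : π.Block) : ℕ := b.1.min' b.nonempty

/-- The largest point of a block. -/
def Block.max (b : π.Block) : ℕ := b.1.max' b.nonempty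

theorem Block.min_mem (b : π.Block) : b.min ∈ b.1 := Finset.min'_mem _ _

theorem Block.max_mem (b : π.Block) : b.max ∈ b.1 := Finset.max'_mem _ _

theorem Block.min_le {b : π.Block} {x : ℕ} (hx : x ∈ b.1) : b.min ≤ x := Finset.min'_le _ _ hx

theorem Block.le_max {b : π.Block} {x : ℕ} (hx : x ∈ b.1) : x ≤ b.max := Finset.le_max' _ _ hx

theorem nest_iff {b b' : π.Block} : π.Nest b b' ↔ ∀ x ∈ b'.1, b.min ≤ x ∧ x ≤ b.max := by
  simp only [Nest, Finset.subset_iff, Finset.mem_Icc]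
  rfl

theorem nest_refl (b : π.Block) : π.Nest b b :=
  nest_iff.2 fun _ hx => ⟨Block.min_le hx, Block.le_max hx⟩

theorem exists_block {x : ℕ} (h1 : 1 ≤ x) (h2 : x ≤ π.size) : ∃ b : π.Block, x ∈ b.1 := by
  obtain ⟨b, hb, hx⟩ := π.part.exists_mem (Finset.mem_Icc.2 ⟨h1, h2⟩)
  exact ⟨⟨b, hb⟩, hx⟩

theorem Block.mem_bounds {b : π.Block} {x : ℕ} (hx : x ∈ b.1) : 1 ≤ x ∧ x ≤ π.size :=
  Finset.mem_Icc.1 (π.part.le b.2 hx)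

/-- Otherwise `d` has a point outside `[min c, max c]` and a point strictly between two points of
`c`, so the two blocks cross. All later uses of the noncrossing condition go through this lemma. -/
theorem nest_of_between {c d : π.Block} {x y z : ℕ} (hx : x ∈ c.1) (hy : y ∈ c.1)
    (hz : z ∈ d.1) (hxz : x ≤ z) (hzy : z ≤ y) : π.Nest c d := by
  by_cases hcd : c = d
  · exact hcd ▸ nest_refl c
  have hne : c.1 ≠ d.1 := fun e => hcd (Subtype.ext e)
  have hxz' : x < z := lt_of_le_of_ne hxz (by rintro rfl; exact hcd (block_eq hx hz))
  have hzy' : z < y := lt_of_le_of_ne hzy (by rintro rfl; exact hcd (block_eq hy hz))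
  refine nest_iff.2 fun t ht => ⟨?_, ?_⟩
  · by_contra! hlt
    exact π.noncrossing d.1 d.2 c.1 c.2 hne.symm t ht z hz x hx y hy
      ⟨hlt.trans_le (Block.min_le hx), hxz', hzy'⟩
  · by_contra! hlt
    exact π.noncrossing c.1 c.2 d.1 d.2 hne x hx y hy z hz t ht
      ⟨hxz', hzy', (Block.le_max hy).trans_lt hlt⟩

/-- Relative ideals: subsets of `A` that are closed upwards in `A`. -/
def IsRelIdeal (A J : Finset π.Block) : Prop :=
  J ⊆ A ∧ ∀ b ∈ J, ∀ b' ∈ A, π.Nest b b' → b' ∈ J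

open Classical in
/-- The finset of relative ideals of `A`. -/
noncomputable def relIdeals (A : Finset π.Block) : Finset (Finset π.Block) :=
  Finset.univ.filter (IsRelIdeal A)

theorem mem_relIdeals {A J : Finset π.Block} : J ∈ relIdeals A ↔ IsRelIdeal A J := by
  simp [relIdeals]

theorem isRelIdeal_univ {J : Finset π.Block} : IsRelIdeal Finset.univ J ↔ π.IsIdeal J := by
  simp only [IsRelIdeal, IsIdeal, Finset.subset_univ, true_and, Finset.mem_univ, true_imp_iff]
  exact ⟨fun h b b' hb => h b hb b', fun h b hb b' => h b b' hb⟩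

theorem filter_isIdeal :
    (Finset.univ : Finset (Finset π.Block)).filter π.IsIdeal = relIdeals Finset.univ := by
  ext J
  rw [mem_relIdeals, isRelIdeal_univ, Finset.mem_filter, and_iff_right (Finset.mem_univ _)]

/-- Two blocks are connected by `J` in `A` if all blocks of `A` that have a point between the
minima of these two blocks are in `J`. -/
def Conn (A J : Finset π.Block) (b b' : π.Block) : Prop :=
  ∀ c ∈ A, ∀ x ∈ c.1, x ∈ Set.uIcc b.min b'.min → c ∈ J

theorem Conn.symm {A J : Finset π.Block} {b b' : π.Block} (h : Conn A J b b') : Conn A J b' b := by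
  unfold Conn
  rw [Set.uIcc_comm]
  exact h

theorem Conn.trans {A J : Finset π.Block} {a b c : π.Block} (h : Conn A J a b)
    (h' : Conn A J b c) : Conn A J a c := by
  intro d hd x hx hxu
  rcases Set.uIcc_subset_uIcc_union_uIcc (b := b.min) hxu with hx' | hx'
  · exact h d hd x hx hx'
  · exact h' d hd x hx hx'

theorem Conn.refl {A J : Finset π.Block} {b : π.Block} (hb : b ∈ J) : Conn A J b b := by
  intro d _ x hx hxu
  rw [Set.uIcc_self, Set.mem_singleton_iff] at hxu
  rwa [block_eq hx (hxu ▸ b.min_mem)]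

/-- All points between the two minima lie inside `[min b, max b]`, hence in blocks nested in `b`. So
a class contains every block of `J` nested in one of its members, and relative ideals of `J` can be
chosen class by class. -/
theorem Conn.of_nest {A J : Finset π.Block} (hJ : IsRelIdeal A J) {b b' : π.Block} (hb : b ∈ J)
    (h : π.Nest b b') : Conn A J b b' := by
  intro c hc x hx hxu
  have h1 := (nest_iff.1 h _ b'.min_mem)
  rw [Set.uIcc_of_le h1.1] at hxu
  exact hJ.2 b hb c hc (nest_of_between b.min_mem b.max_mem hx hxu.1 (hxu.2.trans h1.2))

/-- A block of `J` with a point between the minima of two connected blocks is connected to them. -/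
theorem Conn.of_between {A J : Finset π.Block} (hJ : IsRelIdeal A J) {b b' c : π.Block} {x : ℕ}
    (h : Conn A J b b') (hc : c ∈ J) (hx : x ∈ c.1) (hxu : x ∈ Set.uIcc b.min b'.min) :
    Conn A J b c := by
  intro d hd z hz hzu
  have hcx : c.min ≤ x := Block.min_le hx
  -- The minimum of `c` may fall outside the interval between the minima of `b` and `b'`. Points
  -- from it up to `x` are handled by nesting in `c`; the others lie in that interval.
  by_cases hzx : c.min ≤ z ∧ z ≤ x
  · exact hJ.2 c hc d hd (nest_of_between c.min_mem hx hz hzx.1 hzx.2)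
  · refine h d hd z hz ?_
    rw [Set.mem_uIcc] at *
    omega

open Classical in
/-- The class of a block for the connectivity relation. -/
noncomputable def cls (A J : Finset π.Block) (b : π.Block) : Finset π.Block :=
  J.filter (Conn A J b)

theorem conn_iff_cls {A J : Finset π.Block} {b b' : π.Block} (hb : b ∈ J) :
    Conn A J b b' ↔ cls A J b = cls A J b' := by
  classical
  constructor
  · intro h
    exact Finset.filter_congr fun c _ => ⟨fun h' => h.symm.trans h', fun h' => h.trans h'⟩
  · intro h
    have : b ∈ cls A J b := by simp [cls, hb, Conn.refl hb]
    rw [h] at this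
    exact ((Finset.mem_filter.1 this).2).symm

theorem mem_union {J : Finset π.Block} {x : ℕ} : x ∈ π.union J ↔ ∃ b ∈ J, x ∈ b.1 := by
  simp [union]

theorem mem_of_mem_union {J : Finset π.Block} {b : π.Block} {x : ℕ} (hx : x ∈ π.union J)
    (hb : x ∈ b.1) : b ∈ J := by
  obtain ⟨c, hc, hxc⟩ := mem_union.1 hx
  rwa [block_eq hb hxc]

theorem mem_component {I : Finset ℕ} {a x : ℕ} :
    x ∈ component I a ↔ Finset.uIcc a x ⊆ I := by
  rw [component, Finset.mem_filter]
  exact ⟨fun h => h.2, fun h => ⟨h Finset.right_mem_uIcc, h⟩⟩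

theorem component_eq_iff {I : Finset ℕ} {a a' : ℕ} (ha : a ∈ I) :
    component I a = component I a' ↔ Finset.uIcc a a' ⊆ I := by
  constructor
  · intro h
    have : a ∈ component I a := by simp [mem_component, ha]
    rw [h, mem_component, Finset.uIcc_comm] at this
    exact this
  · intro h
    ext x
    rw [mem_component, mem_component]
    simp only [Finset.subset_iff, Finset.mem_uIcc'] at *
    constructor
    · intro h' z hz
      by_cases hh : a ≤ z ∧ z ≤ a' ∨ a' ≤ z ∧ z ≤ a
      · exact h hh
      · exact h' (by omega)
    · intro h' z hz
      by_cases hh : a ≤ z ∧ z ≤ a' ∨ a' ≤ z ∧ z ≤ a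
      · exact h hh
      · exact h' (by omega)

/-- Every integer of `[1, size]` lies in some block, so a condition on the blocks met between two
minima is a condition on the whole interval. With blocks deleted this fails, hence the ambient set
in `Conn`. -/
theorem conn_iff_component {J : Finset π.Block} {b b' : π.Block} (hb : b ∈ J) :
    Conn Finset.univ J b b' ↔
      component (π.union J) b.min = component (π.union J) b'.min := by
  rw [component_eq_iff (subset_union hb b.min_mem)]
  constructor
  · intro h x hx
    have hb1 := Block.mem_bounds b.min_mem
    have hb2 := Block.mem_bounds b'.min_mem
    have hx' := Finset.mem_uIcc'.1 hx
    obtain ⟨c, hc⟩ := exists_block (π := π) (x := x) (by omega) (by omega)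
    exact subset_union (h c (Finset.mem_univ _) x hc (Set.mem_uIcc.2 hx')) hc
  · intro h c _ x hx hxu
    exact mem_of_mem_union (h (Finset.mem_uIcc'.2 (Set.mem_uIcc.1 hxu))) hx

/-- Points between `b.min` and `x` lie in blocks nested in `b`, which the ideal contains. This is
why minima suffice to describe components. -/
theorem component_eq_min {J : Finset π.Block} (hJ : π.IsIdeal J) {b : π.Block} (hb : b ∈ J)
    {x : ℕ} (hx : x ∈ b.1) : component (π.union J) x = component (π.union J) b.min := by
  rw [component_eq_iff (subset_union hb hx)]
  intro z hz
  have hz' := Finset.mem_uIcc'.1 hz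
  have h1 := Block.mem_bounds b.min_mem
  have h2 := Block.mem_bounds hx
  have h3 := Block.min_le hx
  obtain ⟨c, hc⟩ := exists_block (π := π) (x := z) (by omega) (by omega)
  exact subset_union (hJ b c hb (nest_of_between b.min_mem hx hc (by omega) (by omega))) hc

theorem components_union {J : Finset π.Block} (hJ : π.IsIdeal J) :
    components (π.union J) = J.image fun b => component (π.union J) b.min := by
  ext C
  simp only [components, Finset.mem_image]
  constructor
  · rintro ⟨x, hx, rfl⟩
    obtain ⟨b, hb, hxb⟩ := mem_union.1 hx
    exact ⟨b, hb, (component_eq_min hJ hb hxb).symm⟩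
  · rintro ⟨b, hb, rfl⟩
    exact ⟨b.min, subset_union hb b.min_mem, rfl⟩

theorem filter_subset_component {J : Finset π.Block} (hJ : π.IsIdeal J) {a : ℕ}
    (ha : a ∈ π.union J) :
    (Finset.univ.filter fun b : π.Block => b.1 ⊆ component (π.union J) a) =
      J.filter fun b => component (π.union J) b.min = component (π.union J) a := by
  ext b
  simp only [Finset.mem_filter, Finset.mem_univ, true_and]
  constructor
  · intro h
    have h1 := mem_component.1 (h b.min_mem)
    exact ⟨mem_of_mem_union (h1 Finset.right_mem_uIcc) b.min_mem,
      ((component_eq_iff ha).2 h1).symm⟩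
  · rintro ⟨hb, h⟩ x hx
    rw [← h, ← component_eq_min hJ hb hx]
    simp [mem_component, subset_union hb hx]

end NCPart

/-! ### Products over connectivity classes -/

namespace NCAlg
open NCPart
variable (K : Type*) [Field K] {π : NCPart}

open Classical in
/-- The product of the restrictions of `π` to the classes of `J` for connectivity in `A`. -/
noncomputable def relDot (A J : Finset π.Block) : NCAlg K :=
  ∏ S ∈ J.image (cls A J), restrict K π S

theorem restrict_empty : restrict K π ∅ = 1 := by simp [restrict]

/-- Labels that are not attained contribute `restrict K π ∅ = 1`, so products over different sets of
classes can be brought to a common index set. -/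
theorem relDot_eq {ι : Type*} [DecidableEq ι] {A J : Finset π.Block} (c : π.Block → ι)
    (h : ∀ b ∈ J, ∀ b' ∈ J, Conn A J b b' ↔ c b = c b') (T : Finset ι) (hT : ∀ b ∈ J, c b ∈ T) :
    relDot K A J = ∏ i ∈ T, restrict K π (J.filter (c · = i)) := by
  classical
  exact Finset.prod_image_filter_rel J (Conn A J) c h (restrict K π) (restrict_empty K) T hT

theorem relDot_eq_cls [DecidableEq (Finset π.Block)] (A J : Finset π.Block) :
    relDot K A J = ∏ i, restrict K π (J.filter (cls A J · = i)) :=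
  relDot_eq K _ (fun _ hb _ _ => conn_iff_cls hb) _ fun _ _ => Finset.mem_univ _

theorem restrictDot_eq {J : Finset π.Block} (hJ : π.IsIdeal J) :
    restrictDot K π J = relDot K Finset.univ J := by
  rw [relDot_eq K (fun b => component (π.union J) b.min)
    (fun b hb b' _ => conn_iff_component hb) (components (π.union J))
    (by rw [components_union hJ]; exact fun b hb => Finset.mem_image_of_mem _ hb), restrictDot]
  refine Finset.prod_congr rfl fun C hC => ?_
  obtain ⟨a, ha, rfl⟩ := Finset.mem_image.1 hC
  rw [filter_subset_component hJ ha]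

end NCAlg

/-! ### Blocks, ideals and connectivity of a restriction -/

namespace NCPart

variable {π : NCPart}

theorem rank_mono (I : Finset ℕ) : Monotone (rank I) := fun _ _ h =>
  Finset.card_le_card fun z hz => by
    simp only [Finset.mem_filter] at hz ⊢
    exact ⟨hz.1, hz.2.trans h⟩

theorem rank_le_iff {I : Finset ℕ} {x y : ℕ} (hx : x ∈ I) (hy : y ∈ I) :
    rank I x ≤ rank I y ↔ x ≤ y := by
  rw [← not_lt, ← not_lt, rank_lt_iff hy hx]

/-- `rank U` is strictly increasing on `U`, and a rank depends only on relative order. This makes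
two successive relabellings equal to one in `restrict_restrict`. -/
theorem rank_image_rank {U I : Finset ℕ} (hI : I ⊆ U) {x : ℕ} (hx : x ∈ I) :
    rank (I.image (rank U)) (rank U x) = rank I x := by
  unfold rank
  have : (I.image (rank U)).filter (· ≤ rank U x) = (I.filter (· ≤ x)).image (rank U) := by
    ext k
    simp only [Finset.mem_filter, Finset.mem_image]
    constructor
    · rintro ⟨⟨y, hy, rfl⟩, hk⟩
      exact ⟨y, ⟨hy, (rank_le_iff (hI hy) (hI hx)).1 hk⟩, rfl⟩
    · rintro ⟨y, ⟨hy, hyx⟩, rfl⟩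
      exact ⟨⟨y, hy, rfl⟩, rank_mono U hyx⟩
  change ((I.image (rank U)).filter (· ≤ rank U x)).card = _
  rw [this, Finset.card_image_of_injOn]
  exact (rank_injOn U).mono fun y hy => hI (Finset.mem_filter.1 hy).1

theorem restrict_parts (J : Finset π.Block) (hJ : J.Nonempty) :
    (π.restrict J hJ).part.parts = J.image fun b => b.1.image (rank (π.union J)) := rfl

/-- The block of a restriction that corresponds to a block of `π`. -/
def toRestrict (A : Finset π.Block) (hA : A.Nonempty) (b : A) : (π.restrict A hA).Block :=
  ⟨b.1.1.image (rank (π.union A)), Finset.mem_image_of_mem _ b.2⟩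

theorem toRestrict_bijective (A : Finset π.Block) (hA : A.Nonempty) :
    Function.Bijective (toRestrict A hA) := by
  constructor
  · intro b b' h
    have h' : b.1.1.image (rank (π.union A)) = b'.1.1.image (rank (π.union A)) :=
      congrArg Subtype.val h
    have hm := Finset.mem_image_of_mem (rank (π.union A)) b.1.min_mem
    rw [h'] at hm
    obtain ⟨y, hy, hxy⟩ := Finset.mem_image.1 hm
    have := rank_injOn _ (subset_union b'.2 hy) (subset_union b.2 b.1.min_mem) hxy
    exact Subtype.ext (block_eq b.1.min_mem (this ▸ hy))
  · rintro ⟨t, ht⟩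
    obtain ⟨b, hb, rfl⟩ := Finset.mem_image.1 ht
    exact ⟨⟨b, hb⟩, rfl⟩

/-- The blocks of the restriction `π_{|A}`, seen as blocks of `π`. -/
noncomputable def ofRestrict (A : Finset π.Block) (hA : A.Nonempty) :
    (π.restrict A hA).Block ↪ π.Block :=
  (Equiv.ofBijective _ (toRestrict_bijective A hA)).symm.toEmbedding.trans
    (Function.Embedding.subtype _)

section

variable {A : Finset π.Block} {hA : A.Nonempty}

theorem ofRestrict_mem (t : (π.restrict A hA).Block) : ofRestrict A hA t ∈ A :=
  ((Equiv.ofBijective _ (toRestrict_bijective A hA)).symm t).2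

theorem ofRestrict_spec (t : (π.restrict A hA).Block) :
    t.1 = (ofRestrict A hA t).1.image (rank (π.union A)) :=
  congrArg Subtype.val
    ((Equiv.ofBijective _ (toRestrict_bijective A hA)).apply_symm_apply t).symm

theorem exists_ofRestrict {b : π.Block} (hb : b ∈ A) : ∃ t, ofRestrict A hA t = b :=
  ⟨Equiv.ofBijective _ (toRestrict_bijective A hA) ⟨b, hb⟩, by
    simp only [ofRestrict, Function.Embedding.trans_apply, Equiv.coe_toEmbedding,
      Equiv.symm_apply_apply, Function.Embedding.subtype_apply]⟩

theorem ofRestrict_subset (t : (π.restrict A hA).Block) : (ofRestrict A hA t).1 ⊆ π.union A :=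
  subset_union (ofRestrict_mem t)

theorem map_ofRestrict_subset (T : Finset (π.restrict A hA).Block) :
    T.map (ofRestrict A hA) ⊆ A := by
  intro b hb
  obtain ⟨t, -, rfl⟩ := Finset.mem_map.1 hb
  exact ofRestrict_mem t

theorem map_ofRestrict_univ : Finset.univ.map (ofRestrict A hA) = A := by
  refine (map_ofRestrict_subset _).antisymm fun b hb => ?_
  obtain ⟨t, rfl⟩ := exists_ofRestrict (hA := hA) hb
  simp

theorem mem_restrict_block {t : (π.restrict A hA).Block} {x : ℕ} (hx : x ∈ π.union A) :
    rank (π.union A) x ∈ t.1 ↔ x ∈ (ofRestrict A hA t).1 := by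
  rw [ofRestrict_spec t, Finset.mem_image]
  constructor
  · rintro ⟨y, hy, h⟩
    rwa [← rank_injOn _ (ofRestrict_subset t hy) hx h]
  · exact fun h => ⟨x, h, rfl⟩

theorem restrict_min (t : (π.restrict A hA).Block) :
    t.min = rank (π.union A) (ofRestrict A hA t).min := by
  have h1 : t.min ≤ rank (π.union A) (ofRestrict A hA t).min :=
    Block.min_le ((mem_restrict_block (ofRestrict_subset t (Block.min_mem _))).2 (Block.min_mem _))
  refine le_antisymm h1 ?_
  have h2 := t.min_mem
  rw [ofRestrict_spec t] at h2
  obtain ⟨y, hy, hyt⟩ := Finset.mem_image.1 h2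
  rw [← hyt]
  exact rank_mono _ (Block.min_le hy)

theorem restrict_max (t : (π.restrict A hA).Block) :
    t.max = rank (π.union A) (ofRestrict A hA t).max := by
  have h1 : rank (π.union A) (ofRestrict A hA t).max ≤ t.max :=
    Block.le_max ((mem_restrict_block (ofRestrict_subset t (Block.max_mem _))).2 (Block.max_mem _))
  refine le_antisymm ?_ h1
  have h2 := t.max_mem
  rw [ofRestrict_spec t] at h2
  obtain ⟨y, hy, hyt⟩ := Finset.mem_image.1 h2
  rw [← hyt]
  exact rank_mono _ (Block.le_max hy)

theorem restrict_nest {t t' : (π.restrict A hA).Block} :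
    (π.restrict A hA).Nest t t' ↔ π.Nest (ofRestrict A hA t) (ofRestrict A hA t') := by
  have hm := ofRestrict_subset t (Block.min_mem _)
  have hM := ofRestrict_subset t (Block.max_mem _)
  rw [nest_iff, nest_iff, restrict_min, restrict_max, ofRestrict_spec t', Finset.forall_mem_image]
  refine forall₂_congr fun x hx => ?_
  have hx' := ofRestrict_subset t' hx
  rw [rank_le_iff hm hx', rank_le_iff hx' hM]

theorem union_map (T : Finset (π.restrict A hA).Block) :
    (π.restrict A hA).union T = (π.union (T.map (ofRestrict A hA))).image (rank (π.union A)) := by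
  ext k
  simp only [mem_union, Finset.mem_image, Finset.mem_map]
  constructor
  · rintro ⟨t, ht, hk⟩
    rw [ofRestrict_spec t] at hk
    obtain ⟨x, hx, rfl⟩ := Finset.mem_image.1 hk
    exact ⟨x, ⟨_, ⟨t, ht, rfl⟩, hx⟩, rfl⟩
  · rintro ⟨x, ⟨_, ⟨t, ht, rfl⟩, hx⟩, rfl⟩
    exact ⟨t, ht, (mem_restrict_block (ofRestrict_subset t hx)).2 hx⟩

theorem union_mono {J J' : Finset π.Block} (h : J ⊆ J') : π.union J ⊆ π.union J' :=
  Finset.biUnion_subset_biUnion_of_subset_left _ h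

theorem restrict_restrict (T : Finset (π.restrict A hA).Block) (hT : T.Nonempty) :
    (π.restrict A hA).restrict T hT =
      π.restrict (T.map (ofRestrict A hA)) (hT.map) := by
  have hsub := union_mono (map_ofRestrict_subset T)
  apply ext_of_parts
  · change ((π.restrict A hA).union T).card = (π.union _).card
    rw [union_map, Finset.card_image_of_injOn ((rank_injOn _).mono hsub)]
  · rw [restrict_parts, restrict_parts (T.map _), Finset.map_eq_image, Finset.image_image]
    refine Finset.image_congr fun t ht => ?_
    rw [union_map]
    change t.1.image _ = (ofRestrict A hA t).1.image _
    rw [ofRestrict_spec t, Finset.image_image]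
    refine Finset.image_congr fun x hx => ?_
    rw [← Finset.map_eq_image]
    exact rank_image_rank hsub (subset_union (Finset.mem_map_of_mem _ ht) hx)

/-- The relabelling preserves betweenness of points in blocks of `A`, and the points of deleted
blocks no longer separate anything. Thus absolute connectivity in the restriction is connectivity
relative to `A`. -/
theorem restrict_conn {T : Finset (π.restrict A hA).Block} {t t' : (π.restrict A hA).Block} :
    Conn Finset.univ T t t' ↔
      Conn A (T.map (ofRestrict A hA)) (ofRestrict A hA t) (ofRestrict A hA t') := by
  have hm := ofRestrict_subset t (Block.min_mem _)
  have hm' := ofRestrict_subset t' (Block.min_mem _)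
  have key : ∀ x ∈ π.union A, rank (π.union A) x ∈ Set.uIcc t.min t'.min ↔
      x ∈ Set.uIcc (ofRestrict A hA t).min (ofRestrict A hA t').min := by
    intro x hx
    rw [restrict_min, restrict_min, Set.mem_uIcc, Set.mem_uIcc, rank_le_iff hm hx,
      rank_le_iff hx hm', rank_le_iff hm' hx, rank_le_iff hx hm]
  constructor
  · intro h c hc x hx hxu
    obtain ⟨s, rfl⟩ := exists_ofRestrict (hA := hA) hc
    exact Finset.mem_map_of_mem _ (h s (Finset.mem_univ _) _
      ((mem_restrict_block (ofRestrict_subset s hx)).2 hx)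
      ((key x (ofRestrict_subset s hx)).2 hxu))
  · intro h s _ k hk hku
    rw [ofRestrict_spec s] at hk
    obtain ⟨x, hx, rfl⟩ := Finset.mem_image.1 hk
    exact (Finset.mem_map' _).1
      (h _ (ofRestrict_mem s) x hx ((key x (ofRestrict_subset s hx)).1 hku))

theorem restrict_isRelIdeal {T : Finset (π.restrict A hA).Block} :
    IsRelIdeal Finset.univ T ↔ IsRelIdeal A (T.map (ofRestrict A hA)) := by
  constructor
  · rintro ⟨-, h⟩
    refine ⟨map_ofRestrict_subset T, fun b hb b' hb' hn => ?_⟩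
    obtain ⟨t, ht, rfl⟩ := Finset.mem_map.1 hb
    obtain ⟨t', rfl⟩ := exists_ofRestrict (hA := hA) hb'
    exact Finset.mem_map_of_mem _ (h t ht t' (Finset.mem_univ _) (restrict_nest.2 hn))
  · rintro ⟨-, h⟩
    refine ⟨Finset.subset_univ _, fun t ht t' _ hn => (Finset.mem_map' _).1
      (h _ (Finset.mem_map_of_mem _ ht) _ (ofRestrict_mem t') (restrict_nest.1 hn))⟩

theorem relIdeals_eq_map : relIdeals A =
    (relIdeals Finset.univ).map (Finset.mapEmbedding (ofRestrict A hA)).toEmbedding := by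
  ext J
  simp only [Finset.mem_map, mem_relIdeals, RelEmbedding.coe_toEmbedding,
    Finset.mapEmbedding_apply]
  constructor
  · intro hJ
    classical
    have : (Finset.univ.filter fun t => ofRestrict A hA t ∈ J).map (ofRestrict A hA) = J := by
      ext b
      simp only [Finset.mem_map, Finset.mem_filter, Finset.mem_univ, true_and]
      constructor
      · rintro ⟨t, ht, rfl⟩; exact ht
      · intro hb
        obtain ⟨t, rfl⟩ := exists_ofRestrict (hA := hA) (hJ.1 hb)
        exact ⟨t, hb, rfl⟩
    exact ⟨_, restrict_isRelIdeal.2 (this.symm ▸ hJ), this⟩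
  · rintro ⟨T, hT, rfl⟩
    exact restrict_isRelIdeal.1 hT

theorem map_ofRestrict_compl (T : Finset (π.restrict A hA).Block) :
    Tᶜ.map (ofRestrict A hA) = A \ T.map (ofRestrict A hA) := by
  classical
  rw [Finset.compl_eq_univ_sdiff, Finset.map_sdiff, map_ofRestrict_univ]

theorem numBlocks_restrict : (π.restrict A hA).numBlocks = A.card := by
  conv_rhs => rw [← map_ofRestrict_univ (hA := hA), Finset.card_map]
  simp [numBlocks]

end

theorem union_univ : π.union Finset.univ = Finset.Icc 1 π.size := by
  ext x
  rw [mem_union, Finset.mem_Icc]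
  exact ⟨fun ⟨b, _, hb⟩ => Block.mem_bounds hb, fun h =>
    (exists_block h.1 h.2).imp fun b hb => ⟨Finset.mem_univ _, hb⟩⟩

theorem univ_nonempty : (Finset.univ : Finset π.Block).Nonempty := by
  obtain ⟨b, -⟩ := exists_block (π := π) le_rfl π.size_pos
  exact ⟨b, Finset.mem_univ _⟩

theorem restrict_univ (h : (Finset.univ : Finset π.Block).Nonempty) :
    π.restrict Finset.univ h = π := by
  apply ext_of_parts
  · change (π.union Finset.univ).card = _
    rw [union_univ, Nat.card_Icc, Nat.add_sub_cancel]
  · have key : ∀ b : π.Block, b.1.image (rank (π.union Finset.univ)) = b.1 := by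
      intro b
      conv_rhs => rw [← Finset.image_id (s := b.1)]
      refine Finset.image_congr fun x hx => ?_
      have hx' := Block.mem_bounds hx
      rw [union_univ, rank]
      have : (Finset.Icc 1 π.size).filter (· ≤ x) = Finset.Icc 1 x := by
        ext y
        simp only [Finset.mem_filter, Finset.mem_Icc]
        omega
      simp [this]
    rw [restrict_parts]
    ext p
    simp only [key, Finset.mem_image, Finset.mem_univ, true_and]
    exact ⟨fun ⟨b, hb⟩ => hb ▸ b.2, fun h => ⟨⟨p, h⟩, rfl⟩⟩

end NCPart

/-! ### The coproduct of a restriction -/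

namespace NCAlg
open NCPart
variable (K : Type*) [Field K] {π : NCPart}

theorem restrict_of_nonempty {J : Finset π.Block} (hJ : J.Nonempty) :
    restrict K π J = of K (π.restrict J hJ) := by simp [restrict, hJ]

theorem restrict_univ : restrict K π Finset.univ = of K π := by
  rw [restrict_of_nonempty K univ_nonempty, NCPart.restrict_univ]

theorem restrict_restrict {A : Finset π.Block} {hA : A.Nonempty}
    (T : Finset (π.restrict A hA).Block) :
    restrict K (π.restrict A hA) T = restrict K π (T.map (ofRestrict A hA)) := by
  rcases T.eq_empty_or_nonempty with rfl | hT
  · simp [restrict_empty]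
  · rw [restrict_of_nonempty K hT, restrict_of_nonempty K hT.map, NCPart.restrict_restrict]

theorem relDot_restrict {A : Finset π.Block} {hA : A.Nonempty}
    (T : Finset (π.restrict A hA).Block) :
    relDot K Finset.univ T = relDot K A (T.map (ofRestrict A hA)) := by
  classical
  -- The blocks of the restriction are labelled by classes in `π`, so both products run over the
  -- same labels.
  rw [relDot_eq K (fun t => cls A (T.map (ofRestrict A hA)) (ofRestrict A hA t))
    (fun t ht t' _ => restrict_conn.trans (conn_iff_cls (Finset.mem_map_of_mem _ ht)))
    Finset.univ (fun _ _ => Finset.mem_univ _), relDot_eq_cls]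
  refine Finset.prod_congr rfl fun S _ => ?_
  rw [restrict_restrict, Finset.map_filter']
  congr 1
  ext b
  simp only [Finset.mem_map, Finset.mem_filter]
  constructor
  · rintro ⟨⟨t, ht, rfl⟩, t', ht'', ht'⟩
    exact ⟨⟨t, ht, rfl⟩, by rw [← ht', ht'']⟩
  · rintro ⟨⟨t, ht, rfl⟩, h⟩
    exact ⟨⟨t, ht, rfl⟩, t, h, rfl⟩

theorem comul_of (π : NCPart) : comul K (of K π) =
    ∑ J ∈ relIdeals (Finset.univ : Finset π.Block),
      restrict K π Jᶜ ⊗ₜ[K] relDot K Finset.univ J := by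
  simp only [comul, of, MvPolynomial.aeval_X]
  rw [filter_isIdeal]
  refine Finset.sum_congr rfl fun J hJ => ?_
  rw [restrictDot_eq K (isRelIdeal_univ.1 (mem_relIdeals.1 hJ))]

theorem relDot_empty (A : Finset π.Block) : relDot K A ∅ = 1 := by simp [relDot]

theorem comul_restrict (A : Finset π.Block) : comul K (restrict K π A) =
    ∑ J ∈ relIdeals A, restrict K π (A \ J) ⊗ₜ[K] relDot K A J := by
  rcases A.eq_empty_or_nonempty with rfl | hA
  · have : relIdeals (∅ : Finset π.Block) = {∅} := by
      ext J
      rw [mem_relIdeals, Finset.mem_singleton]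
      exact ⟨fun h => Finset.subset_empty.1 h.1, by rintro rfl; simp [IsRelIdeal]⟩
    rw [this, Finset.sum_singleton, relDot_empty, Finset.sdiff_empty, restrict_empty, map_one]
    rfl
  · rw [restrict_of_nonempty K hA, comul_of, relIdeals_eq_map (hA := hA), Finset.sum_map]
    refine Finset.sum_congr rfl fun T _ => ?_
    rw [relDot_restrict, restrict_restrict, map_ofRestrict_compl]
    rfl

end NCAlg

/-! ### Coassociativity -/

namespace NCPart

variable {π : NCPart}

/-- Deleting blocks of `J` removes no obstruction to connectivity by `J`. So the classes of what
remains are the traces of the classes of `J`, and no two classes merge. -/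
theorem Conn.sdiff_iff {J I : Finset π.Block} (hI : I ⊆ J) {b b' : π.Block} :
    Conn Iᶜ (J \ I) b b' ↔ Conn Finset.univ J b b' := by
  constructor
  · intro h c _ x hx hxu
    by_cases hc : c ∈ I
    · exact hI hc
    · exact (Finset.mem_sdiff.1 (h c (Finset.mem_compl.2 hc) x hx hxu)).1
  · intro h c hc x hx hxu
    exact Finset.mem_sdiff.2 ⟨h c (Finset.mem_univ _) x hx hxu, Finset.mem_compl.1 hc⟩

theorem IsRelIdeal.trans {A J I : Finset π.Block} (hJ : IsRelIdeal A J) (hI : IsRelIdeal J I) :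
    IsRelIdeal A I :=
  ⟨hI.1.trans hJ.1, fun b hb b' hb' h => hI.2 b hb b' (hJ.2 b (hI.1 hb) b' hb' h) h⟩

theorem IsRelIdeal.union {J I : Finset π.Block} (hJ : IsRelIdeal Finset.univ J)
    (hI : IsRelIdeal Jᶜ I) : IsRelIdeal Finset.univ (J ∪ I) ∧ IsRelIdeal (J ∪ I) J := by
  refine ⟨⟨Finset.subset_univ _, fun b hb b' _ h => ?_⟩, Finset.subset_union_left,
    fun b hb b' _ h => hJ.2 b hb b' (Finset.mem_univ _) h⟩
  rw [Finset.mem_union]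
  by_cases hb' : b' ∈ J
  · exact Or.inl hb'
  · rcases Finset.mem_union.1 hb with hb | hb
    · exact Or.inl (hJ.2 b hb b' (Finset.mem_univ _) h)
    · exact Or.inr (hI.2 b hb b' (Finset.mem_compl.2 hb') h)

theorem IsRelIdeal.sdiff {J I : Finset π.Block} (hJ : IsRelIdeal Finset.univ J) :
    IsRelIdeal Iᶜ (J \ I) := by
  refine ⟨fun b hb => Finset.mem_compl.2 (Finset.mem_sdiff.1 hb).2, fun b hb b' hb' h => ?_⟩
  exact Finset.mem_sdiff.2 ⟨hJ.2 b (Finset.mem_sdiff.1 hb).1 b' (Finset.mem_univ _) h,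
    Finset.mem_compl.1 hb'⟩

theorem Conn.of_subset {A J I : Finset π.Block} (hI : I ⊆ J) {b b' : π.Block}
    (h : Conn A I b b') : Conn A J b b' :=
  fun c hc x hx hxu => hI (h c hc x hx hxu)

open Classical in
-- A block met between two minima of one class of `J` is in `J` and, by `Conn.of_between`, in the
-- same class. Testing the blocks of this class alone is therefore enough.
theorem Conn.class_iff {J I : Finset π.Block} (hJ : IsRelIdeal Finset.univ J)
    (hI : I ⊆ J) {i : Finset π.Block} {b b' : π.Block}
    (hb : b ∈ I.filter (cls Finset.univ J · = i)) (hb' : b' ∈ I.filter (cls Finset.univ J · = i)) :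
    Conn (J.filter (cls Finset.univ J · = i)) (I.filter (cls Finset.univ J · = i)) b b' ↔
      Conn Finset.univ I b b' := by
  rw [Finset.mem_filter] at hb hb'
  constructor
  · intro h c _ x hx hxu
    have hbb' : Conn Finset.univ J b b' := (conn_iff_cls (hI hb.1)).2 (hb.2.trans hb'.2.symm)
    have hcJ := hbb' c (Finset.mem_univ _) x hx hxu
    have hbc := (conn_iff_cls (hI hb.1)).1 (hbb'.of_between hJ hcJ hx hxu)
    exact (Finset.mem_filter.1
      (h c (Finset.mem_filter.2 ⟨hcJ, hbc.symm.trans hb.2⟩) x hx hxu)).1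
  · intro h c hc x hx hxu
    exact Finset.mem_filter.2 ⟨h c (Finset.mem_univ _) x hx hxu, (Finset.mem_filter.1 hc).2⟩

end NCPart

namespace NCAlg
open NCPart
variable (K : Type*) [Field K] {π : NCPart}

open Classical in
theorem prod_restrict_class_sdiff {J I : Finset π.Block} (hI : I ⊆ J) :
    ∏ i, restrict K π ((J \ I).filter (cls Finset.univ J · = i)) = relDot K Iᶜ (J \ I) :=
  (relDot_eq K _ (fun _ hb _ _ => (Conn.sdiff_iff hI).trans
    (conn_iff_cls (Finset.mem_sdiff.1 hb).1)) _ fun _ _ => Finset.mem_univ _).symm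

open Classical in
-- The classes of `I` refine those of `J`. After exchanging the products, each class of `I` meets
-- exactly one class of `J`, and the other factors are `restrict K π ∅ = 1`.
theorem prod_relDot_class {J I : Finset π.Block} (hJ : IsRelIdeal Finset.univ J) (hI : I ⊆ J) :
    ∏ i, relDot K (J.filter (cls Finset.univ J · = i)) (I.filter (cls Finset.univ J · = i)) =
      relDot K Finset.univ I := by
  rw [relDot_eq_cls]
  have h1 : ∀ i : Finset π.Block,
      relDot K (J.filter (cls Finset.univ J · = i)) (I.filter (cls Finset.univ J · = i)) =
      ∏ j, restrict K π ((I.filter (cls Finset.univ J · = i)).filter (cls Finset.univ I · = j)) :=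
    fun i => relDot_eq K _ (fun b hb b' hb' => (Conn.class_iff hJ hI hb hb').trans
      (conn_iff_cls (Finset.mem_filter.1 hb).1)) _ fun _ _ => Finset.mem_univ _
  rw [Finset.prod_congr rfl fun i _ => h1 i, Finset.prod_comm]
  refine Finset.prod_congr rfl fun j _ => ?_
  rcases (I.filter (cls Finset.univ I · = j)).eq_empty_or_nonempty with h | ⟨b, hb⟩
  · rw [h, restrict_empty]
    refine Finset.prod_eq_one fun i _ => ?_
    rw [Finset.filter_comm, h, Finset.filter_empty, restrict_empty]
  · have hb' := Finset.mem_filter.1 hb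
    have key : ∀ b' ∈ I.filter (cls Finset.univ I · = j),
        cls Finset.univ J b' = cls Finset.univ J b := fun b' hm =>
      ((conn_iff_cls (hI hb'.1)).1 (((conn_iff_cls hb'.1).2
        (hb'.2.trans (Finset.mem_filter.1 hm).2.symm)).of_subset hI)).symm
    rw [Finset.prod_eq_single (cls Finset.univ J b)]
    · rw [Finset.filter_comm, Finset.filter_true_of_mem key]
    · intro i _ hi
      rw [Finset.filter_comm, Finset.filter_false_of_mem, restrict_empty]
      intro b' hm h
      exact hi (h.symm.trans (key b' hm))
    · exact fun h => absurd (Finset.mem_univ _) h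

theorem prod_tmul {ι : Type*} (s : Finset ι) (f g : ι → NCAlg K) :
    ∏ i ∈ s, f i ⊗ₜ[K] g i = (∏ i ∈ s, f i) ⊗ₜ[K] ∏ i ∈ s, g i := by
  classical
  induction s using Finset.induction_on with
  | empty => rfl
  | insert a s ha ih =>
    rw [Finset.prod_insert ha, Finset.prod_insert ha, Finset.prod_insert ha, ih,
      Algebra.TensorProduct.tmul_mul_tmul]

theorem comul_relDot {J : Finset π.Block} (hJ : IsRelIdeal Finset.univ J) :
    comul K (relDot K Finset.univ J) =
      ∑ I ∈ relIdeals J, relDot K Iᶜ (J \ I) ⊗ₜ[K] relDot K Finset.univ I := by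
  classical
  -- Expanding the product of the coproducts of the classes gives a sum over families `p` of
  -- relative ideals, one in each class. Taking unions identifies these families with the relative
  -- ideals of `J`.
  rw [relDot_eq_cls, map_prod, Finset.prod_congr rfl fun i _ => comul_restrict K _,
    Finset.prod_univ_sum]
  have hp : ∀ p ∈ Fintype.piFinset fun i => relIdeals (J.filter (cls Finset.univ J · = i)),
      ∀ i, (Finset.univ.biUnion p).filter (cls Finset.univ J · = i) = p i := by
    intro p hp i
    have hp := fun i => mem_relIdeals.1 (Fintype.mem_piFinset.1 hp i)
    ext b
    simp only [Finset.mem_filter, Finset.mem_biUnion, Finset.mem_univ, true_and]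
    constructor
    · rintro ⟨⟨j, hj⟩, rfl⟩
      rwa [(Finset.mem_filter.1 ((hp j).1 hj)).2]
    · exact fun hb => ⟨⟨i, hb⟩, (Finset.mem_filter.1 ((hp i).1 hb)).2⟩
  have hmem : ∀ p ∈ Fintype.piFinset fun i => relIdeals (J.filter (cls Finset.univ J · = i)),
      IsRelIdeal J (Finset.univ.biUnion p) := by
    intro p hp
    have hp := fun i => mem_relIdeals.1 (Fintype.mem_piFinset.1 hp i)
    refine ⟨fun b hb => ?_, fun b hb b' hb' hn => ?_⟩
    · obtain ⟨i, -, hi⟩ := Finset.mem_biUnion.1 hb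
      exact (Finset.mem_filter.1 ((hp i).1 hi)).1
    · obtain ⟨i, -, hi⟩ := Finset.mem_biUnion.1 hb
      have hb := Finset.mem_filter.1 ((hp i).1 hi)
      refine Finset.mem_biUnion.2 ⟨i, Finset.mem_univ _, (hp i).2 b hi b' ?_ hn⟩
      exact Finset.mem_filter.2
        ⟨hb', ((conn_iff_cls hb.1).1 (Conn.of_nest hJ hb.1 hn)).symm.trans hb.2⟩
  refine Finset.sum_bij' (fun p _ => Finset.univ.biUnion p)
    (fun I _ i => I.filter (cls Finset.univ J · = i)) (fun p h => mem_relIdeals.2 (hmem p h))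
    ?_ (fun p h => funext (hp p h)) ?_ ?_
  · intro I hI
    rw [mem_relIdeals] at hI
    refine Fintype.mem_piFinset.2 fun i => mem_relIdeals.2
      ⟨Finset.filter_subset_filter _ hI.1, fun b hb b' hb' hn => ?_⟩
    exact Finset.mem_filter.2 ⟨hI.2 b (Finset.mem_filter.1 hb).1 b' (Finset.mem_filter.1 hb').1 hn,
      (Finset.mem_filter.1 hb').2⟩
  · intro I hI
    ext b
    simp only [Finset.mem_biUnion, Finset.mem_univ, true_and, Finset.mem_filter]
    exact ⟨fun ⟨_, h, _⟩ => h, fun h => ⟨_, h, rfl⟩⟩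
  · intro p h
    have hI := (hmem p h).1
    have hs : ∀ i, (J \ Finset.univ.biUnion p).filter (cls Finset.univ J · = i) =
        J.filter (cls Finset.univ J · = i) \ p i := by
      intro i
      rw [← hp p h i]
      ext b
      simp only [Finset.mem_filter, Finset.mem_sdiff]
      tauto
    rw [prod_tmul, ← prod_restrict_class_sdiff K hI, ← prod_relDot_class K hJ hI]
    simp only [hs, hp p h]

/-- The coproduct is coassociative. -/
theorem comul_coassoc :
    (Algebra.TensorProduct.assoc K K K (NCAlg K) (NCAlg K) (NCAlg K)).toAlgHom.comp
      ((Algebra.TensorProduct.map (comul K) (.id K (NCAlg K))).comp (comul K)) =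
    (Algebra.TensorProduct.map (.id K (NCAlg K)) (comul K)).comp (comul K) := by
  refine MvPolynomial.algHom_ext fun π => ?_
  change (Algebra.TensorProduct.assoc K K K (NCAlg K) (NCAlg K) (NCAlg K))
    (Algebra.TensorProduct.map (comul K) (.id K (NCAlg K)) (comul K (of K π))) =
    Algebra.TensorProduct.map (.id K (NCAlg K)) (comul K) (comul K (of K π))
  rw [comul_of, map_sum, map_sum, map_sum]
  have hL : ∀ J : Finset π.Block, (Algebra.TensorProduct.assoc K K K (NCAlg K) (NCAlg K) (NCAlg K))
      (Algebra.TensorProduct.map (comul K) (.id K (NCAlg K))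
        (restrict K π Jᶜ ⊗ₜ[K] relDot K Finset.univ J)) =
      ∑ I ∈ relIdeals Jᶜ, restrict K π (Jᶜ \ I) ⊗ₜ[K] (relDot K Jᶜ I ⊗ₜ[K]
        relDot K Finset.univ J) := by
    intro J
    rw [Algebra.TensorProduct.map_tmul, comul_restrict, TensorProduct.sum_tmul, map_sum]
    rfl
  have hR : ∀ J ∈ relIdeals (Finset.univ : Finset π.Block),
      Algebra.TensorProduct.map (.id K (NCAlg K)) (comul K)
        (restrict K π Jᶜ ⊗ₜ[K] relDot K Finset.univ J) =
      ∑ I ∈ relIdeals J, restrict K π Jᶜ ⊗ₜ[K] (relDot K Iᶜ (J \ I) ⊗ₜ[K]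
        relDot K Finset.univ I) := by
    intro J hJ
    rw [Algebra.TensorProduct.map_tmul, comul_relDot K (mem_relIdeals.1 hJ),
      TensorProduct.tmul_sum]
    rfl
  rw [Finset.sum_congr rfl fun J _ => hL J, Finset.sum_congr rfl hR, Finset.sum_sigma',
    Finset.sum_sigma']
  -- On the left `J` is cut off first, then `I` from its complement; on the right `J ∪ I` is cut off
  -- first and then split into `I` and `J`.
  refine Finset.sum_bij' (fun p _ => ⟨p.1 ∪ p.2, p.1⟩) (fun p _ => ⟨p.2, p.1 \ p.2⟩) ?_ ?_ ?_ ?_ ?_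
  · rintro ⟨J, I⟩ h
    simp only [Finset.mem_sigma, mem_relIdeals] at h ⊢
    exact IsRelIdeal.union h.1 h.2
  · rintro ⟨J, I⟩ h
    simp only [Finset.mem_sigma, mem_relIdeals] at h ⊢
    exact ⟨h.1.trans h.2, IsRelIdeal.sdiff h.1⟩
  · rintro ⟨J, I⟩ h
    simp only [Finset.mem_sigma, mem_relIdeals] at h ⊢
    rw [Finset.union_sdiff_cancel_left (Finset.disjoint_left.2 fun b hb hb' =>
      Finset.mem_compl.1 (h.2.1 hb') hb)]
  · rintro ⟨J, I⟩ h
    simp only [Finset.mem_sigma, mem_relIdeals] at h ⊢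
    rw [Finset.union_sdiff_of_subset h.2.1]
  · rintro ⟨J, I⟩ h
    simp only [Finset.mem_sigma, mem_relIdeals] at h ⊢
    rw [Finset.union_sdiff_cancel_left (Finset.disjoint_left.2 fun b hb hb' =>
      Finset.mem_compl.1 (h.2.1 hb') hb), Finset.compl_union, Finset.sdiff_eq_inter_compl]

end NCAlg

/-! ### Convolution inverses and antipodes -/

section Convolution

open WithConv

variable {K H A : Type*} [Field K] [CommRing H] [Bialgebra K H] [CommRing A] [Algebra K A]

/-- If all characters with values in `H` have a left inverse for convolution, then `H` has a unique
antipode. -/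
theorem Bialgebra.existsUnique_antipode
    (h : ∀ f : H →ₐ[K] H, ∃ g : H →ₐ[K] H,
      (Algebra.TensorProduct.lmul' K).comp ((Algebra.TensorProduct.map g f).comp
        (Bialgebra.comulAlgHom K H)) = (Algebra.ofId K H).comp (Bialgebra.counitAlgHom K H)) :
    ∃! S : H →ₗ[K] H,
      LinearMap.mul' K H ∘ₗ S.rTensor H ∘ₗ Coalgebra.comul =
        Algebra.linearMap K H ∘ₗ Coalgebra.counit ∧
      LinearMap.mul' K H ∘ₗ S.lTensor H ∘ₗ Coalgebra.comul =
        Algebra.linearMap K H ∘ₗ Coalgebra.counit := by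
  have h' : ∀ f : WithConv (H →ₗ[K] H), (∃ f' : H →ₐ[K] H, f = toConv f'.toLinearMap) →
      ∃ g : H →ₐ[K] H, toConv g.toLinearMap * f = 1 := by
    rintro _ ⟨f, rfl⟩
    obtain ⟨g, hg⟩ := h f
    exact ⟨g, congrArg (fun f => toConv f.toLinearMap) hg⟩
  obtain ⟨S, hS⟩ := h' (toConv LinearMap.id) ⟨AlgHom.id K H, rfl⟩
  -- The left inverse `S` of the identity is itself a character, so it has a left inverse `T`.
  -- Associativity forces `T = id`, hence `S` is also a right inverse.
  obtain ⟨T, hT⟩ := h' _ ⟨S, rfl⟩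
  have hS' : toConv LinearMap.id * toConv S.toLinearMap = 1 := by
    rwa [← left_inv_eq_right_inv hT hS]
  refine ⟨S.toLinearMap, ⟨congrArg ofConv hS, congrArg ofConv hS'⟩, fun U hU => ?_⟩
  have hU' : toConv U * toConv LinearMap.id = 1 := congrArg toConv hU.1
  exact toConv_injective (left_inv_eq_right_inv hU' hS')

/-- The composition of a character with an antipode is the left inverse of this character for
convolution. -/
theorem Bialgebra.comp_antipode_eq {f g : H →ₐ[K] A} {S : H →ₗ[K] H}
    (hfg : (Algebra.TensorProduct.lmul' K).comp ((Algebra.TensorProduct.map f g).comp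
        (Bialgebra.comulAlgHom K H)) = (Algebra.ofId K A).comp (Bialgebra.counitAlgHom K H))
    (hS : LinearMap.mul' K H ∘ₗ S.lTensor H ∘ₗ Coalgebra.comul =
        Algebra.linearMap K H ∘ₗ Coalgebra.counit) (x : H) : g (S x) = f x := by
  have h1 : toConv f.toLinearMap * toConv g.toLinearMap = 1 :=
    congrArg (fun f => toConv f.toLinearMap) hfg
  have hS' : toConv LinearMap.id * toConv S = 1 := congrArg toConv hS
  -- Composition with the algebra morphism `g` distributes over convolution: `g * (g ∘ S) = g ∘ (id
  -- * S)`.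
  have h2 : toConv g.toLinearMap * toConv (g.toLinearMap.comp S) = 1 := by
    have := LinearMap.algHom_comp_convMul_distrib g (toConv LinearMap.id) (toConv S)
    rw [hS'] at this
    refine (congrArg toConv this).symm.trans ?_
    ext x
    exact g.commutes _
  exact (congrArg (fun f => f.ofConv x) (left_inv_eq_right_inv h1 h2)).symm

end Convolution

/-! ### The antipode and the convolution inverse of `lamS` -/

namespace NCPart

variable {π : NCPart}

open Classical in
/-- The blocks that are maximal for the nesting order. -/
noncomputable def maxBlocks (π : NCPart) : Finset π.Block :=
  Finset.univ.filter fun b => ∀ b', π.Nest b b' → b = b'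

theorem maxBlocks_nonempty (π : NCPart) : π.maxBlocks.Nonempty := by
  -- A block with the largest minimum works, since strict nesting raises the minimum.
  obtain ⟨b, -, hb⟩ := Finset.exists_max_image Finset.univ Block.min (univ_nonempty (π := π))
  refine ⟨b, Finset.mem_filter.2 ⟨Finset.mem_univ _, fun b' h => ?_⟩⟩
  have := le_antisymm (hb b' (Finset.mem_univ _)) (nest_iff.1 h _ b'.min_mem).1
  exact block_eq b.min_mem (this ▸ b'.min_mem)

theorem isRelIdeal_of_subset_maxBlocks {J : Finset π.Block} (hJ : J ⊆ π.maxBlocks) :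
    IsRelIdeal Finset.univ J :=
  ⟨Finset.subset_univ _, fun _ hb b' _ h => (Finset.mem_filter.1 (hJ hb)).2 b' h ▸ hb⟩

theorem empty_mem_relIdeals : ∅ ∈ relIdeals (Finset.univ : Finset π.Block) :=
  mem_relIdeals.2 (isRelIdeal_of_subset_maxBlocks (Finset.empty_subset _))

theorem univ_mem_relIdeals : Finset.univ ∈ relIdeals (Finset.univ : Finset π.Block) :=
  mem_relIdeals.2 ⟨subset_rfl, fun _ _ _ _ _ => Finset.mem_univ _⟩

theorem base_restrict_eq_univ {A : Finset π.Block} {hA : A.Nonempty} :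
    (π.restrict A hA).base = Finset.univ ↔ ∀ b ∈ A, ∀ b' ∈ A, π.Nest b b' → b = b' := by
  rw [base, Finset.filter_eq_self]
  constructor
  · intro h b hb b' hb' hn
    obtain ⟨t, rfl⟩ := exists_ofRestrict (hA := hA) hb
    obtain ⟨t', rfl⟩ := exists_ofRestrict (hA := hA) hb'
    rw [h t' (Finset.mem_univ _) t (restrict_nest.2 hn)]
  · intro h t _ t' hn
    exact (ofRestrict A hA).injective
      (h _ (ofRestrict_mem t') _ (ofRestrict_mem t) (restrict_nest.1 hn))

end NCPart

namespace NCAlg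
open NCPart
variable (K : Type*) [Field K] {π : NCPart}

theorem relDot_univ : relDot K Finset.univ (Finset.univ : Finset π.Block) = of K π := by
  rw [relDot_eq K (fun _ => ())
    (fun b _ b' _ => iff_of_true (fun c _ _ _ _ => Finset.mem_univ c) rfl)
    {()} (fun _ _ => Finset.mem_singleton_self _), Finset.prod_singleton]
  simp only [Finset.filter_true, restrict_univ]

theorem counit_of (π : NCPart) : counit K (of K π) = 0 := by simp [counit, of]

theorem counit_restrict {J : Finset π.Block} (hJ : J.Nonempty) :
    counit K (restrict K π J) = 0 := by
  rw [restrict_of_nonempty K hJ, counit_of]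

theorem mem_cls_self {A J : Finset π.Block} {b : π.Block} (hb : b ∈ J) : b ∈ cls A J b := by
  classical
  exact Finset.mem_filter.2 ⟨hb, Conn.refl hb⟩

theorem counit_relDot {A J : Finset π.Block} (hJ : J.Nonempty) :
    counit K (relDot K A J) = 0 := by
  classical
  obtain ⟨b, hb⟩ := hJ
  rw [relDot, map_prod]
  exact Finset.prod_eq_zero (Finset.mem_image_of_mem _ hb)
    (counit_restrict K ⟨b, mem_cls_self hb⟩)

theorem comul_counit_left :
    (Algebra.TensorProduct.map (counit K) (.id K (NCAlg K))).comp (comul K) =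
      (Algebra.TensorProduct.lid K (NCAlg K)).symm := by
  refine MvPolynomial.algHom_ext fun π => ?_
  change Algebra.TensorProduct.map (counit K) (.id K (NCAlg K)) (comul K (of K π)) =
    1 ⊗ₜ[K] of K π
  rw [comul_of, map_sum, Finset.sum_eq_single Finset.univ]
  · rw [Algebra.TensorProduct.map_tmul, Finset.compl_univ, restrict_empty, relDot_univ, map_one]
    rfl
  · intro J _ hJ
    rw [Algebra.TensorProduct.map_tmul, counit_restrict, TensorProduct.zero_tmul]
    rwa [Finset.nonempty_iff_ne_empty, Ne, Finset.compl_eq_empty_iff]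
  · exact fun h => absurd univ_mem_relIdeals h

theorem comul_counit_right :
    (Algebra.TensorProduct.map (.id K (NCAlg K)) (counit K)).comp (comul K) =
      (Algebra.TensorProduct.rid K K (NCAlg K)).symm := by
  refine MvPolynomial.algHom_ext fun π => ?_
  change Algebra.TensorProduct.map (.id K (NCAlg K)) (counit K) (comul K (of K π)) =
    of K π ⊗ₜ[K] 1
  rw [comul_of, map_sum, Finset.sum_eq_single ∅]
  · rw [Algebra.TensorProduct.map_tmul, Finset.compl_empty, restrict_univ, relDot_empty, map_one]
    rfl
  · intro J _ hJ
    rw [Algebra.TensorProduct.map_tmul, counit_relDot K (Finset.nonempty_iff_ne_empty.2 hJ),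
      TensorProduct.tmul_zero]
  · exact fun h => absurd empty_mem_relIdeals h

/-- The bialgebra `(𝕂[NCP], m, Δ)`. -/
@[reducible]
noncomputable def bialgebra : Bialgebra K (NCAlg K) :=
  Bialgebra.ofAlgHom (comul K) (counit K) (comul_coassoc K) (comul_counit_left K)
    (comul_counit_right K)

variable {A : Type*} [CommRing A] [Algebra K A]

/-- The convolution product of two characters. -/
noncomputable def conv (f g : NCAlg K →ₐ[K] A) : NCAlg K →ₐ[K] A :=
  (Algebra.TensorProduct.lmul' K).comp ((Algebra.TensorProduct.map f g).comp (comul K))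

theorem conv_of (f g : NCAlg K →ₐ[K] A) (π : NCPart) :
    conv K f g (of K π) = ∑ J ∈ relIdeals (Finset.univ : Finset π.Block),
      f (restrict K π Jᶜ) * g (relDot K Finset.univ J) := by
  change Algebra.TensorProduct.lmul' K (Algebra.TensorProduct.map f g (comul K (of K π))) = _
  rw [comul_of, map_sum, map_sum]
  rfl

theorem eq_counit {f : NCAlg K →ₐ[K] A} (h : ∀ π, f (of K π) = 0) :
    f = (Algebra.ofId K A).comp (counit K) := by
  refine MvPolynomial.algHom_ext fun π => (h π).trans ?_
  change (0 : A) = algebraMap K A (counit K (of K π))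
  rw [counit_of, map_zero]

/-- The values on the generators of the inverse of a character for convolution. -/
noncomputable def convInvAux (f : NCAlg K →ₐ[K] A) (π : NCPart) : A :=
  -∑ J ∈ (relIdeals (Finset.univ : Finset π.Block)).erase ∅,
    -- Nonemptiness of `J` is automatic after erasing `∅`, but the termination proof needs it. The
    -- other branch is thus `Jᶜ = ∅`, where the left factor is 1.
    if h : J.Nonempty ∧ Jᶜ.Nonempty then
      convInvAux f (π.restrict Jᶜ h.2) * f (relDot K Finset.univ J)
    else f (relDot K Finset.univ J)
termination_by π.numBlocks
decreasing_by
  have h1 := Finset.card_pos.2 h.1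
  have h2 := Finset.card_add_card_compl J
  have h3 : Fintype.card π.Block = π.numBlocks := by simp [numBlocks]
  rw [numBlocks_restrict]
  omega

/-- In `(g * f)(π)` the term `J = ∅` is `g(π)`, and the others involve `g` only on restrictions with
fewer blocks or on 1. So the equation can be solved for `g(π)`, and freeness extends `g` to a
character. -/
theorem exists_conv_eq_counit (f : NCAlg K →ₐ[K] A) :
    ∃ g : NCAlg K →ₐ[K] A, conv K g f = (Algebra.ofId K A).comp (counit K) := by
  refine ⟨MvPolynomial.aeval (convInvAux K f), eq_counit K fun π => ?_⟩
  rw [conv_of, ← Finset.add_sum_erase _ _ empty_mem_relIdeals, relDot_empty, Finset.compl_empty,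
    restrict_univ, map_one, mul_one, of, MvPolynomial.aeval_X, convInvAux, neg_add_eq_zero]
  refine Finset.sum_congr rfl fun J hJ => ?_
  have hJ' := Finset.nonempty_iff_ne_empty.2 (Finset.mem_erase.1 hJ).1
  by_cases hc : Jᶜ.Nonempty
  · rw [dif_pos ⟨hJ', hc⟩, restrict_of_nonempty K hc, of, MvPolynomial.aeval_X]
  · rw [dif_neg fun h => hc h.2, Finset.not_nonempty_iff_eq_empty.1 hc, restrict_empty, map_one,
      one_mul]

theorem existsUnique_antipode : ∃! S : NCAlg K →ₗ[K] NCAlg K, IsAntipode K S :=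
  letI := bialgebra K
  Bialgebra.existsUnique_antipode (H := NCAlg K) (exists_conv_eq_counit K)

/-- The character that sends `π` to `(-1)^{|π|}`. -/
noncomputable def sign : NCAlg K →ₐ[K] K := MvPolynomial.aeval fun π => (-1) ^ π.numBlocks

theorem sign_restrict (J : Finset π.Block) : sign K (restrict K π J) = (-1) ^ J.card := by
  rcases J.eq_empty_or_nonempty with rfl | hJ
  · simp [restrict_empty]
  · rw [restrict_of_nonempty K hJ, of, sign, MvPolynomial.aeval_X, numBlocks_restrict]

open Classical in
theorem lamS_restrict (J : Finset π.Block) : lamS K (restrict K π J) =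
    if ∀ b ∈ J, ∀ b' ∈ J, π.Nest b b' → b = b' then 1 else 0 := by
  rcases J.eq_empty_or_nonempty with rfl | hJ
  · simp [restrict_empty]
  · rw [restrict_of_nonempty K hJ, of, lamS, MvPolynomial.aeval_X]
    simp only [base_restrict_eq_univ]

open Classical in
-- If a block of `J` is not maximal in `π`, a different block nested in it belongs to the ideal `J`
-- and to the same class, and the factor of this class vanishes. Maximal blocks are pairwise
-- incomparable.
theorem lamS_relDot {J : Finset π.Block} (hJ : IsRelIdeal Finset.univ J) :
    lamS K (relDot K Finset.univ J) = if J ⊆ π.maxBlocks then 1 else 0 := by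
  rw [relDot, map_prod]
  split_ifs with h
  · refine Finset.prod_eq_one fun S hS => ?_
    obtain ⟨c, hc, rfl⟩ := Finset.mem_image.1 hS
    rw [lamS_restrict, if_pos]
    exact fun b hb b' _ hn =>
      (Finset.mem_filter.1 (h (Finset.mem_filter.1 hb).1)).2 b' hn
  · obtain ⟨b, hb, hbm⟩ := Finset.not_subset.1 h
    refine Finset.prod_eq_zero (Finset.mem_image_of_mem _ hb) ?_
    rw [lamS_restrict, if_neg]
    intro hS
    refine hbm (Finset.mem_filter.2 ⟨Finset.mem_univ _, fun b' hn => ?_⟩)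
    exact hS b (mem_cls_self hb) b' (Finset.mem_filter.2
      ⟨hJ.2 b hb b' (Finset.mem_univ _) hn, Conn.of_nest hJ hb hn⟩) hn

/-- The surviving terms give `(-1)^|π|` times the sum of `(-1)^|J|` over all subsets `J` of the
nonempty set `maxBlocks`, all of which are ideals. -/
theorem sign_conv_lamS :
    conv K (sign K) (lamS K) = (Algebra.ofId K K).comp (counit K) := by
  classical
  refine eq_counit K fun π => ?_
  have h1 : ∀ J ∈ relIdeals (Finset.univ : Finset π.Block),
      sign K (restrict K π Jᶜ) * lamS K (relDot K Finset.univ J) =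
        if J ⊆ π.maxBlocks then (-1) ^ Jᶜ.card else 0 := by
    intro J hJ
    rw [sign_restrict, lamS_relDot K (mem_relIdeals.1 hJ), mul_ite, mul_one, mul_zero]
  have h2 : (relIdeals (Finset.univ : Finset π.Block)).filter (· ⊆ π.maxBlocks) =
      π.maxBlocks.powerset := by
    ext J
    rw [Finset.mem_filter, Finset.mem_powerset, mem_relIdeals]
    exact ⟨fun h => h.2, fun h => ⟨isRelIdeal_of_subset_maxBlocks h, h⟩⟩
  have h3 : ∀ J : Finset π.Block,
      (-1 : K) ^ Jᶜ.card = (-1) ^ Fintype.card π.Block * (-1) ^ J.card := by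
    intro J
    rw [← Finset.card_add_card_compl J, pow_add, mul_right_comm, ← mul_pow]
    simp
  have h4 := congrArg (Int.cast : ℤ → K)
    (Finset.sum_powerset_neg_one_pow_card_of_nonempty π.maxBlocks_nonempty)
  push_cast at h4
  rw [conv_of, Finset.sum_congr rfl h1, ← Finset.sum_filter, h2,
    Finset.sum_congr rfl fun J _ => h3 J, ← Finset.mul_sum, h4, mul_zero]

theorem lamS_comp_antipode {S : NCAlg K →ₗ[K] NCAlg K} (hS : IsAntipode K S) (π : NCPart) :
    lamS K (S (of K π)) = (-1) ^ π.numBlocks := by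
  let := bialgebra K
  refine (Bialgebra.comp_antipode_eq (H := NCAlg K) (sign_conv_lamS K) hS.2 _).trans ?_
  rw [sign, of, MvPolynomial.aeval_X]

end NCAlg

/-! ### Reciprocity for order polynomials -/

theorem Polynomial.eq_of_eval_natCast {K : Type*} [Field K] [CharZero K] {p q : Polynomial K}
    (h : ∀ n : ℕ, p.eval (n : K) = q.eval (n : K)) : p = q :=
  Polynomial.eq_of_infinite_eval_eq _ _
    ((Set.infinite_range_of_injective (Nat.cast_injective (R := K))).mono
      (by rintro _ ⟨n, rfl⟩; exact h n))

namespace OrderPoly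

variable {α : Type*} [Fintype α] [DecidableEq α] (r : α → α → Prop) (s : Prop)

open Classical in
/-- The maps `F → {0, …, n - 1}` (extended by zero) that are strictly increasing for `r`, or only
increasing if `s` holds. -/
noncomputable def maps (F : Finset α) (n : ℕ) : Finset (α → ℕ) :=
  (Fintype.piFinset fun a => if a ∈ F then Finset.range n else {0}).filter fun g =>
    ∀ a ∈ F, ∀ b ∈ F, r a b → a ≠ b → g a < g b ∨ s ∧ g a = g b

variable {r s}

open Classical in
theorem mem_maps {F : Finset α} {n : ℕ} {g : α → ℕ} : g ∈ maps r s F n ↔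
    (∀ a ∈ F, g a < n) ∧ (∀ a ∉ F, g a = 0) ∧
      ∀ a ∈ F, ∀ b ∈ F, r a b → a ≠ b → g a < g b ∨ s ∧ g a = g b := by
  rw [maps, Finset.mem_filter, Fintype.mem_piFinset, ← and_assoc]
  refine and_congr_left fun _ => ⟨fun h => ⟨fun a ha => ?_, fun a ha => ?_⟩, fun h a => ?_⟩
  · simpa [ha] using h a
  · simpa [ha] using h a
  · by_cases ha : a ∈ F
    · simpa [ha] using h.1 a ha
    · simpa [ha] using h.2 a ha

variable (r s)

open Classical in
/-- The possible fibers of the largest value for the elements of `maps r s F (n + 1)`. -/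
noncomputable def tops (F : Finset α) : Finset (Finset α) :=
  F.powerset.filter fun J => ∀ a ∈ J, ∀ b ∈ F, r a b → a ≠ b → s ∧ b ∈ J

variable {r s}

open Classical in
theorem mem_tops {F J : Finset α} : J ∈ tops r s F ↔
    J ⊆ F ∧ ∀ a ∈ J, ∀ b ∈ F, r a b → a ≠ b → s ∧ b ∈ J := by
  rw [tops, Finset.mem_filter, Finset.mem_powerset]

theorem card_maps_succ (F : Finset α) (n : ℕ) :
    (maps r s F (n + 1)).card = ∑ J ∈ tops r s F, (maps r s (F \ J) n).card := by
  classical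
  rw [Finset.card_eq_sum_card_fiberwise (f := fun g => F.filter (g · = n)) (t := tops r s F)]
  · refine Finset.sum_congr rfl fun J hJ => ?_
    rw [mem_tops] at hJ
    -- The top fibre `J` is removed by resetting its value `n` to the default 0 outside the domain,
    -- and restored by writing `n` back.
    refine Finset.card_bij' (fun g _ a => if a ∈ J then 0 else g a)
      (fun g _ a => if a ∈ J then n else g a) ?_ ?_ ?_ ?_
    · intro g hg
      rw [Finset.mem_filter, mem_maps] at hg
      obtain ⟨⟨h1, h2, h3⟩, rfl⟩ := hg
      refine mem_maps.2 ⟨fun a ha => ?_, fun a ha => ?_, fun a ha b hb => ?_⟩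
      · rw [Finset.mem_sdiff] at ha
        have h4 : g a ≠ n := fun h => ha.2 (Finset.mem_filter.2 ⟨ha.1, h⟩)
        rw [if_neg ha.2]
        have := h1 a ha.1
        omega
      · rw [Finset.mem_sdiff] at ha
        split_ifs with h
        · rfl
        · exact h2 a fun h' => ha ⟨h', h⟩
      · rw [Finset.mem_sdiff] at ha hb
        rw [if_neg ha.2, if_neg hb.2]
        exact h3 a ha.1 b hb.1
    · intro g hg
      rw [mem_maps] at hg
      obtain ⟨h1, h2, h3⟩ := hg
      have h4 : ∀ a ∈ F, a ∉ J → g a < n := fun a ha ha' => h1 a (Finset.mem_sdiff.2 ⟨ha, ha'⟩)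
      refine Finset.mem_filter.2 ⟨mem_maps.2 ⟨fun a ha => ?_, fun a ha => ?_,
        fun a ha b hb hr hne => ?_⟩, ?_⟩
      · split_ifs with h
        · omega
        · exact (h4 a ha h).trans (Nat.lt_succ_self n)
      · rw [if_neg fun h => ha (hJ.1 h)]
        exact h2 a fun h => ha (Finset.mem_sdiff.1 h).1
      · by_cases haJ : a ∈ J
        · have := hJ.2 a haJ b hb hr hne
          simp [haJ, this.2, this.1]
        · by_cases hbJ : b ∈ J
          · simp only [haJ, hbJ, if_true, if_false]
            exact Or.inl (h4 a ha haJ)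
          · simp only [haJ, hbJ, if_false]
            exact h3 a (Finset.mem_sdiff.2 ⟨ha, haJ⟩) b (Finset.mem_sdiff.2 ⟨hb, hbJ⟩) hr hne
      · ext a
        rw [Finset.mem_filter]
        by_cases haJ : a ∈ J
        · simp [haJ, hJ.1 haJ]
        · simp only [haJ, if_false, iff_false, not_and]
          exact fun ha => (h4 a ha haJ).ne
    · intro g hg
      rw [Finset.mem_filter] at hg
      obtain ⟨-, rfl⟩ := hg
      funext a
      by_cases ha : a ∈ F.filter (g · = n)
      · simp only [ha, if_true]
        exact (Finset.mem_filter.1 ha).2.symm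
      · simp only [ha, if_false]
    · intro g hg
      funext a
      by_cases ha : a ∈ J
      · simp only [ha, if_true]
        exact ((mem_maps.1 hg).2.1 a fun h => (Finset.mem_sdiff.1 h).2 ha).symm
      · simp only [ha, if_false]
  · intro g hg
    rw [Finset.mem_coe, mem_maps] at hg
    obtain ⟨h1, -, h3⟩ := hg
    refine Finset.mem_coe.2 (mem_tops.2 ⟨Finset.filter_subset _ _, fun a ha b hb hr hne => ?_⟩)
    rw [Finset.mem_filter] at ha ⊢
    have h5 := h1 b hb
    rcases h3 a ha.1 b hb hr hne with h | ⟨hs, h⟩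
    · omega
    · exact ⟨hs, hb, by omega⟩

theorem card_maps_zero (F : Finset α) :
    (maps r s F 0).card = if F = ∅ then 1 else 0 := by
  split_ifs with h
  · subst h
    rw [Finset.card_eq_one]
    refine ⟨fun _ => 0, ?_⟩
    ext g
    rw [mem_maps, Finset.mem_singleton]
    simp [funext_iff]
  · obtain ⟨a, ha⟩ := Finset.nonempty_iff_ne_empty.2 h
    rw [Finset.card_eq_zero, Finset.eq_empty_iff_forall_notMem]
    exact fun g hg => absurd ((mem_maps.1 hg).1 a ha) (Nat.not_lt_zero _)

variable (r)

open Classical in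
/-- The maximal elements of `F`. -/
noncomputable def maxs (F : Finset α) : Finset α :=
  F.filter fun a => ∀ b ∈ F, r a b → a = b

variable {r}

open Classical in
theorem mem_maxs {F : Finset α} {a : α} : a ∈ maxs r F ↔ a ∈ F ∧ ∀ b ∈ F, r a b → a = b :=
  Finset.mem_filter

theorem tops_false (F : Finset α) : tops r False F = (maxs r F).powerset := by
  ext J
  rw [mem_tops, Finset.mem_powerset]
  constructor
  · rintro ⟨h1, h2⟩ a ha
    exact mem_maxs.2 ⟨h1 ha, fun b hb hr => by_contra fun hne => (h2 a ha b hb hr hne).1⟩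
  · intro h
    exact ⟨fun a ha => (mem_maxs.1 (h ha)).1, fun a ha b hb hr hne =>
      absurd ((mem_maxs.1 (h ha)).2 b hb hr) hne⟩

/-- An element of greatest height in a nonempty up-set `J` is maximal in `F`. The height function is
all that is needed of the order; transitivity plays no role. -/
theorem maxs_inter_eq_empty {h : α → ℕ} (hr : ∀ a b, r a b → a ≠ b → h a < h b)
    {F J : Finset α} (hJ : J ∈ tops r True F) : maxs r F ∩ J = ∅ ↔ J = ∅ := by
  refine ⟨fun hi => ?_, fun hi => by rw [hi, Finset.inter_empty]⟩
  by_contra hne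
  rw [mem_tops] at hJ
  obtain ⟨a, ha, hmax⟩ := Finset.exists_max_image J h (Finset.nonempty_iff_ne_empty.2 hne)
  have : a ∈ maxs r F ∩ J := by
    refine Finset.mem_inter.2 ⟨mem_maxs.2 ⟨hJ.1 ha, fun b hb hab => ?_⟩, ha⟩
    by_contra hn
    exact absurd (hmax b (hJ.2 a ha b hb hab hn).2) (hr a b hab hn).not_ge
  rw [hi] at this
  exact absurd this (Finset.notMem_empty a)

/-- Inversion of the recursion for the numbers of increasing maps. -/
theorem card_maps_true {h : α → ℕ} (hr : ∀ a b, r a b → a ≠ b → h a < h b)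
    (F : Finset α) (n : ℕ) : ((maps r True F n).card : ℤ) =
      ∑ J ∈ (maxs r F).powerset, (-1) ^ J.card * ((maps r True (F \ J) (n + 1)).card : ℤ) := by
  have h1 : ∀ J ∈ (maxs r F).powerset, ((maps r True (F \ J) (n + 1)).card : ℤ) =
      ∑ I ∈ (tops r True F).filter (J ⊆ ·), ((maps r True (F \ I) n).card : ℤ) := by
    intro J hJ
    rw [Finset.mem_powerset] at hJ
    rw [card_maps_succ, Nat.cast_sum]
    -- Since `J` consists of maximal elements, the up-sets of `F \ J` correspond to the up-sets of
    -- `F` that contain `J`.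
    refine Finset.sum_bij' (fun I _ => J ∪ I) (fun I _ => I \ J) ?_ ?_ ?_ ?_ ?_
    · intro I hI
      rw [mem_tops] at hI
      refine Finset.mem_filter.2 ⟨mem_tops.2 ⟨Finset.union_subset
        (fun a ha => (mem_maxs.1 (hJ ha)).1)
        fun a ha => (Finset.mem_sdiff.1 (hI.1 ha)).1, fun a ha b hb hab hne => ⟨trivial, ?_⟩⟩,
        Finset.subset_union_left⟩
      rcases Finset.mem_union.1 ha with ha | ha
      · exact absurd ((mem_maxs.1 (hJ ha)).2 b hb hab) hne
      · by_cases hbJ : b ∈ J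
        · exact Finset.mem_union_left _ hbJ
        · exact Finset.mem_union_right _
            (hI.2 a ha b (Finset.mem_sdiff.2 ⟨hb, hbJ⟩) hab hne).2
    · intro I hI
      rw [Finset.mem_filter, mem_tops] at hI
      refine mem_tops.2 ⟨Finset.sdiff_subset_sdiff hI.1.1 subset_rfl, fun a ha b hb hab hne => ?_⟩
      rw [Finset.mem_sdiff] at ha hb ⊢
      exact ⟨trivial, (hI.1.2 a ha.1 b hb.1 hab hne).2, hb.2⟩
    · intro I hI
      rw [mem_tops] at hI
      exact Finset.union_sdiff_cancel_left (Finset.disjoint_right.2 fun a ha =>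
        (Finset.mem_sdiff.1 (hI.1 ha)).2)
    · intro I hI
      exact Finset.union_sdiff_of_subset (Finset.mem_filter.1 hI).2
    · intro I _
      rw [sdiff_sdiff_left, Finset.sup_eq_union]
  rw [Finset.sum_congr rfl fun J hJ => by rw [h1 J hJ, Finset.mul_sum],
    Finset.sum_comm' (t' := tops r True F) (s' := fun I => (maxs r F ∩ I).powerset)]
  · have h2 : ∀ I ∈ tops r True F, ∑ J ∈ (maxs r F ∩ I).powerset,
        (-1) ^ J.card * ((maps r True (F \ I) n).card : ℤ) =
        if I = ∅ then ((maps r True (F \ I) n).card : ℤ) else 0 := by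
      intro I hI
      rw [← Finset.sum_mul, Finset.sum_powerset_neg_one_pow_card]
      simp only [maxs_inter_eq_empty hr hI, ite_mul, one_mul, zero_mul]
    rw [Finset.sum_congr rfl h2, Finset.sum_ite_eq' , if_pos, Finset.sdiff_empty]
    exact mem_tops.2 ⟨Finset.empty_subset _, by simp⟩
  · intro J I
    simp only [Finset.mem_powerset, Finset.mem_filter, Finset.subset_inter_iff]
    tauto

/-- Reciprocity for the order polynomials, given that all counting functions are polynomial. -/
theorem eq_comp_neg {K : Type*} [Field K] [CharZero K] {h : α → ℕ}
    (hr : ∀ a b, r a b → a ≠ b → h a < h b) (p q : Finset α → Polynomial K)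
    (hp : ∀ F (n : ℕ), (p F).eval (n : K) = ((maps r True F n).card : K))
    (hq : ∀ F (n : ℕ), (q F).eval (n : K) = ((maps r False F n).card : K)) (F : Finset α) :
    p F = (-1) ^ F.card * (q F).comp (-Polynomial.X) := by
  induction F using Finset.strongInduction with
  | H F ih =>
  -- The strict recursion is stated as an identity of polynomials in order to evaluate it at `-(x +
  -- 1)`.
  have hq' : (q F).comp (Polynomial.X + 1) = ∑ J ∈ (maxs r F).powerset, q (F \ J) := by
    refine Polynomial.eq_of_eval_natCast fun n => ?_
    have := hq F (n + 1)
    rw [card_maps_succ, tops_false] at this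
    push_cast at this
    rw [Polynomial.eval_comp, Polynomial.eval_finsetSum]
    simpa [hq] using this
  have hq'' : ∀ x : K, (q F).eval (-x) =
      ∑ J ∈ (maxs r F).powerset, (q (F \ J)).eval (-(x + 1)) := by
    intro x
    have := congrArg (Polynomial.eval (-(x + 1))) hq'
    rw [Polynomial.eval_comp, Polynomial.eval_finsetSum] at this
    rw [← this]
    simp
  have hp' : ∀ n : ℕ, (p F).eval (n : K) =
      ∑ J ∈ (maxs r F).powerset, (-1) ^ J.card * (p (F \ J)).eval ((n : K) + 1) := by
    intro n
    have := congrArg (Int.cast : ℤ → K) (card_maps_true hr F n)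
    push_cast at this
    rw [hp, this]
    refine Finset.sum_congr rfl fun J _ => ?_
    rw [← hp]
    push_cast
    rfl
  set d : Finset α → Polynomial K := fun F => p F - (-1) ^ F.card * (q F).comp (-Polynomial.X)
    with hd
  have hev : ∀ F x, (d F).eval x = (p F).eval x - (-1) ^ F.card * (q F).eval (-x) := by
    intro F x
    simp [hd, Polynomial.eval_comp]
  have hsub : ∀ J ∈ (maxs r F).powerset, J ⊆ F := fun J hJ =>
    (Finset.mem_powerset.1 hJ).trans fun _ ha => (mem_maxs.1 ha).1
  -- Both sides satisfy the same recursion, and by induction only the term `J = ∅` of the difference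
  -- `d` survives. Hence `d F` is constant on the natural numbers.
  have hstep : ∀ n : ℕ, (d F).eval (n : K) = (d F).eval ((n : K) + 1) := by
    intro n
    have h1 : (d F).eval (n : K) =
        ∑ J ∈ (maxs r F).powerset, (-1) ^ J.card * (d (F \ J)).eval ((n : K) + 1) := by
      rw [hev, hp', hq'', Finset.mul_sum, ← Finset.sum_sub_distrib]
      refine Finset.sum_congr rfl fun J hJ => ?_
      rw [hev, mul_sub, ← mul_assoc, ← pow_add, add_comm J.card,
        Finset.card_sdiff_add_card_eq_card (hsub J hJ)]
    rw [h1, Finset.sum_eq_single ∅]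
    · simp
    · intro J hJ hne
      have : d (F \ J) = 0 := by
        rw [hd]
        exact sub_eq_zero.2 (ih _ (Finset.sdiff_ssubset (hsub J hJ)
          (Finset.nonempty_iff_ne_empty.2 hne)))
      simp [this]
    · exact fun hn => absurd (Finset.empty_mem_powerset _) hn
  -- With no available value, both counts are 1 if `F` is empty and 0 otherwise.
  have hzero : (d F).eval ((0 : ℕ) : K) = 0 := by
    rw [hev]
    have := hq F 0
    rw [card_maps_zero] at this
    rw [Nat.cast_zero] at this
    rw [hp, card_maps_zero, Nat.cast_zero, neg_zero, this]
    split_ifs with hF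
    · simp [hF]
    · simp
  refine sub_eq_zero.1 (Polynomial.eq_of_eval_natCast (q := 0) fun n => ?_ : d F = 0)
  rw [Polynomial.eval_zero]
  induction n with
  | zero => exact hzero
  | succ n ihn => rw [Nat.cast_succ, ← hstep, ihn]

/-- Increasing maps on a type that is in bijection with `F`. -/
theorem card_subtype_eq_card_maps {β : Type*} [Finite β] (e : β → α)
    (he : Function.Injective e) {F : Finset α} (hF : ∀ a, a ∈ F ↔ ∃ b, e b = a) (n : ℕ) :
    Nat.card {f : β → Fin n // ∀ b b', r (e b) (e b') → b ≠ b' → f b < f b' ∨ s ∧ f b = f b'} =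
      (maps r s F n).card := by
  classical
  have := Fintype.ofFinite β
  rw [Nat.card_eq_fintype_card, Fintype.card_subtype]
  have hext : ∀ (f : β → Fin n) b, Function.extend e (fun b => (f b : ℕ)) 0 (e b) = f b :=
    fun f b => he.extend_apply _ _ b
  refine Finset.card_bij (fun f _ => Function.extend e (fun b => (f b : ℕ)) 0) ?_ ?_ ?_
  · intro f hf
    refine mem_maps.2 ⟨fun a ha => ?_, fun a ha => ?_, fun a ha a' ha' hr hne => ?_⟩
    · obtain ⟨b, rfl⟩ := (hF a).1 ha
      rw [hext]
      exact (f b).2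
    · rw [Function.extend_apply' _ _ _ fun h => ha ((hF a).2 h)]
      rfl
    · obtain ⟨b, rfl⟩ := (hF a).1 ha
      obtain ⟨b', rfl⟩ := (hF a').1 ha'
      rw [hext, hext]
      have := (Finset.mem_filter.1 hf).2 b b' hr fun h => hne (congrArg e h)
      rwa [Fin.lt_def, Fin.ext_iff] at this
  · intro f _ f' _ h
    funext b
    have := congrFun h (e b)
    rw [hext, hext] at this
    exact Fin.ext this
  · intro g hg
    rw [mem_maps] at hg
    refine ⟨fun b => ⟨g (e b), hg.1 _ ((hF _).2 ⟨b, rfl⟩)⟩, Finset.mem_filter.2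
      ⟨Finset.mem_univ _, fun b b' hr hne => ?_⟩, ?_⟩
    · rw [Fin.lt_def, Fin.ext_iff]
      exact hg.2.2 _ ((hF _).2 ⟨b, rfl⟩) _ ((hF _).2 ⟨b', rfl⟩) hr fun h => hne (he h)
    · funext a
      by_cases ha : ∃ b, e b = a
      · obtain ⟨b, rfl⟩ := ha
        exact he.extend_apply _ _ b
      · rw [Function.extend_apply' _ _ _ ha, hg.2.1 a fun h => ha ((hF a).1 h)]
        rfl

variable (r s) in
-- Sorting maps by their image expresses the count through binomial coefficients in `n`, which are
-- polynomial. The value at `n = 0` is included because the induction in `eq_comp_neg` is anchored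
-- there.
theorem exists_poly (K : Type*) [Field K] [CharZero K] (F : Finset α) :
    ∃ p : Polynomial K, ∀ n : ℕ, p.eval (n : K) = ((maps r s F n).card : K) := by
  set Q : (n : ℕ) → (F → Fin n) → Prop := fun n f =>
    ∀ b b' : F, r b b' → b ≠ b' → f b < f b' ∨ s ∧ f b = f b' with hQ
  refine ⟨∑ k ∈ Finset.range (Fintype.card F + 1),
    Polynomial.C ((Nat.card {f : F → Fin k // Q k f ∧ Function.Surjective f} : K) /
      (k.factorial : K)) * descPochhammer K k, fun n => ?_⟩
  rw [← card_subtype_eq_card_maps (fun b : F => (b : α)) Subtype.val_injective (by simp),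
    NCMon.card_eq_sum_choose Q (fun k n e f => by simp [hQ]) n, Polynomial.eval_finsetSum,
    Nat.cast_sum]
  refine Finset.sum_congr rfl fun k _ => ?_
  rw [Polynomial.eval_mul, Polynomial.eval_C, descPochhammer_eval_eq_descFactorial,
    Nat.descFactorial_eq_factorial_mul_choose]
  have : (k.factorial : K) ≠ 0 := by exact_mod_cast k.factorial_ne_zero
  push_cast
  field_simp

end OrderPoly

/-! ### Linear extensions of a noncrossing partition -/

namespace NCPart

theorem min_lt_of_nest {π : NCPart} {b b' : π.Block} (h : π.Nest b b') (hne : b ≠ b') :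
    b.min < b'.min :=
  lt_of_le_of_ne (nest_iff.1 h _ b'.min_mem).1
    fun e => hne (block_eq b.min_mem (e ▸ b'.min_mem))

end NCPart

namespace NCMon
open NCPart

variable {π : NCPart}

theorem eq_of_single (i : Σ σ : (Finsupp.single π 1).support, Fin (Finsupp.single π 1 σ.1)) :
    i.1.1 = π :=
  Finset.mem_singleton.1 (Finsupp.support_single_subset i.1.2)

/-- The blocks of the monomial `π` are the blocks of `π`. -/
def ofSingle (π : NCPart) (x : Bl (Finsupp.single π 1)) : π.Block :=
  -- Only the membership proof is transported, so the underlying set of points is unchanged by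
  -- definition.
  ⟨x.2.1, (congrArg (fun σ : NCPart => x.2.1 ∈ σ.part.parts) (eq_of_single x.1)).mp x.2.2⟩

theorem ofSingle_fst_eq (i j : Σ σ : (Finsupp.single π 1).support, Fin (Finsupp.single π 1 σ.1)) :
    i = j := by
  obtain ⟨⟨σ, hσ⟩, k⟩ := i
  obtain ⟨⟨τ, hτ⟩, l⟩ := j
  obtain rfl : σ = π := eq_of_single ⟨⟨σ, hσ⟩, k⟩
  obtain rfl : τ = σ := eq_of_single ⟨⟨τ, hτ⟩, l⟩
  have hk := k.2
  have hl := l.2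
  simp only [Finsupp.single_eq_same] at hk hl
  congr 1
  exact Fin.ext (by omega)

theorem ofSingle_injective (π : NCPart) : Function.Injective (ofSingle π) := by
  rintro ⟨i, b⟩ ⟨j, c⟩ h
  obtain rfl := ofSingle_fst_eq i j
  have : (ofSingle π ⟨i, b⟩).1 = (ofSingle π ⟨i, c⟩).1 := congrArg Subtype.val h
  exact congrArg _ (Subtype.ext this)

theorem ofSingle_surjective (π : NCPart) : Function.Surjective (ofSingle π) := fun b =>
  ⟨⟨⟨⟨π, by simp⟩, ⟨0, by simp⟩⟩, b⟩, rfl⟩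

theorem nest_ofSingle {x y : Bl (Finsupp.single π 1)} :
    Nest _ x y ↔ π.Nest (ofSingle π x) (ofSingle π y) := by
  obtain ⟨i, b⟩ := x
  obtain ⟨j, c⟩ := y
  obtain rfl := ofSingle_fst_eq i j
  exact ⟨fun h => by cases h with | mk _ _ _ h => exact h, fun h => .mk i b c h⟩

theorem isLin_iff {P : NCPart →₀ ℕ} {n : ℕ} {f : Bl P → Fin n} : IsLin P n f ↔
    ∀ b b', Nest P b b' → b ≠ b' → f b < f b' ∨ True ∧ f b = f b' := by
  refine forall₃_congr fun b b' _ => ?_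
  rw [true_and, ← le_iff_lt_or_eq]
  classical
  exact ⟨fun h _ => h, fun h => if e : b = b' then e ▸ le_rfl else h e⟩

theorem card_isLin (π : NCPart) (n : ℕ) :
    Nat.card {f : Bl (Finsupp.single π 1) → Fin n // IsLin (Finsupp.single π 1) n f} =
      (OrderPoly.maps π.Nest True Finset.univ n).card := by
  rw [← OrderPoly.card_subtype_eq_card_maps (ofSingle π) (ofSingle_injective π)
    fun a => iff_of_true (Finset.mem_univ a) (ofSingle_surjective π a)]
  simp only [isLin_iff, nest_ofSingle]

theorem card_isLinS (π : NCPart) (n : ℕ) :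
    Nat.card {f : Bl (Finsupp.single π 1) → Fin n // IsLinS (Finsupp.single π 1) n f} =
      (OrderPoly.maps π.Nest False Finset.univ n).card := by
  rw [← OrderPoly.card_subtype_eq_card_maps (ofSingle π) (ofSingle_injective π)
    fun a => iff_of_true (Finset.mem_univ a) (ofSingle_surjective π a)]
  simp only [IsLinS, nest_ofSingle, false_and, or_false]

end NCMon

namespace NCAlg
open NCPart
variable (K : Type*) [Field K] [CharZero K]

/-- The values at `n ≥ 1` already determine the polynomial, so any polynomial with the right counts
is the chosen one. -/
theorem Lam_of {π : NCPart} {p : Polynomial K} (h : ∀ n : ℕ,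
    p.eval (n : K) = ((OrderPoly.maps π.Nest True Finset.univ n).card : K)) :
    Lam K (of K π) = p := by
  have h1 : Lam K (of K π) = (NCMon.existsUnique_lin K (Finsupp.single π 1)).choose := by
    have := (MvPolynomial.basisMonomials NCPart K).constr_basis K
      (fun P => (NCMon.existsUnique_lin K P).choose) (Finsupp.single π 1)
    rwa [MvPolynomial.coe_basisMonomials] at this
  rw [h1]
  refine (NCMon.existsUnique_lin K _).unique
    (NCMon.existsUnique_lin K (Finsupp.single π 1)).choose_spec.1 fun n _ => ?_
  rw [h, NCMon.card_isLin]

theorem LamS_of {π : NCPart} {p : Polynomial K} (h : ∀ n : ℕ,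
    p.eval (n : K) = ((OrderPoly.maps π.Nest False Finset.univ n).card : K)) :
    LamS K (of K π) = p := by
  have h1 : LamS K (of K π) = (NCMon.existsUnique_linS K (Finsupp.single π 1)).choose := by
    have := (MvPolynomial.basisMonomials NCPart K).constr_basis K
      (fun P => (NCMon.existsUnique_linS K P).choose) (Finsupp.single π 1)
    rwa [MvPolynomial.coe_basisMonomials] at this
  rw [h1]
  refine (NCMon.existsUnique_linS K _).unique
    (NCMon.existsUnique_linS K (Finsupp.single π 1)).choose_spec.1 fun n _ => ?_
  rw [h, NCMon.card_isLinS]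

theorem Lam_of_eq (π : NCPart) : Lam K (of K π) =
    (-1) ^ π.numBlocks * (LamS K (of K π)).comp (-Polynomial.X) := by
  choose p hp using OrderPoly.exists_poly π.Nest True K
  choose q hq using OrderPoly.exists_poly π.Nest False K
  rw [Lam_of K (hp _), LamS_of K (hq _), OrderPoly.eq_comp_neg (h := Block.min)
    (fun _ _ => min_lt_of_nest) p q hp hq]
  simp [numBlocks]

end NCAlg

theorem mainTheorem8 (K : Type*) [Field K] [CharZero K] :
    (∀ π : NCPart, NCAlg.Lam K (NCAlg.of K π) =
      (-1) ^ π.numBlocks * (NCAlg.LamS K (NCAlg.of K π)).comp (-Polynomial.X)) ∧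
    (∃! S : NCAlg K →ₗ[K] NCAlg K, NCAlg.IsAntipode K S) ∧
    (∀ S : NCAlg K →ₗ[K] NCAlg K, NCAlg.IsAntipode K S → ∀ π : NCPart,
      NCAlg.lam K (NCAlg.of K π) =
        (-1) ^ π.numBlocks * NCAlg.lamS K (S (NCAlg.of K π))) := by
  refine ⟨NCAlg.Lam_of_eq K, NCAlg.existsUnique_antipode K, fun S hS π => ?_⟩
  rw [NCAlg.lamS_comp_antipode K hS, ← mul_pow, neg_one_mul, neg_neg, one_pow, NCAlg.lam,
    NCAlg.of, MvPolynomial.aeval_X]
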